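/- Let $A$ be an $n\times n$ matrix over $\mathbb R\cup\{+\infty\}$ and $B$ an $n\times n$ matrix over $\{0,1\}$, $n\ge 1$. The right mixed product $C$ of $A$ and $B$ is given by $C[i,j]=\min(\{A[i,k] : 1\le k\le n,\ B[k,j]=1\}\cup\{+\infty\})$, and the left mixed product $C'$ of $B$ and $A$ by $C'[i,j]=\min(\{A[k,j] : 1\le k\le n,\ B[i,k]=1\}\cup\{+\infty\})$. A witness matrix for $C$ is an $n\times n$ matrix $W$ such that, whenever $C[i,j]\ne+\infty$, the entry $k=W[i,j]$ is an index with $B[k,j]=1$ and $A[i,k]=C[i,j]$; a witness matrix for $C'$ is an $n\times n$ matrix $W'$ such that, whenever $C'[i,j]\neq+\infty$, the entry $k=W'[i,j]$ is an index with $B[i,k]=1$ and $A[k,j]=C'[i,j]$. For a $0$-$1$ matrix $M$, let $MWT(M)$ be the weight of a minimum weight spanning tree of the complete graph on the rows of $M$ in which the weight of an edge is the Hamming distance between its two rows. The model of computation is a random access machine with fair coin tosses and logarithmic cost (each step costs a constant plus the bit lengths of the integers involved). Elements of $\mathbb R\cup\{+\infty\}$ can only be copied and compared, and the only arithmetic,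 on non-negative integers, is addition, truncated subtraction and halving; in this sense the algorithms are combinatorial. For every real $\alpha\ge 1$ the following holds. (a) There are a randomized algorithm (one program for all $n$) and constants $c,d$ such that, for all $n\geq 1$ and all $A,B$ as above, with probability at least $1-n^{-\alpha}$ over its coin tosses, the algorithm on input $A,B$ halts within time $c\,n\,(n+MWT(B^{t}))\,(1+\log n)^{d}$ and outputs the right mixed product $C$ of $A$ and $B$ together with a witness matrix for $C$. That is, the running time is $\widetilde O(n(n+MWT(B^{t})))$. (b) There are a randomized algorithm and constants $c,d$ such that, for all $n\geq 1$ and all $A,B$ as above, with probability at least $1-n^{-\alpha}$ over its coin tosses, the algorithm on input $A,B$ halts within time $c\,n\,(n+MWT(B))\,(1+\log n)^{d}$ and outputs the left mixed product $C'$ of $B$ and $A$ together with a witness matrix for $C'$. That is, the running time is $\widetilde O(n(n+MWT(B)))$. -/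

import Mathlib

open MeasureTheory

namespace MixedProduct

/-! ### Matrices: mixed products, witness matrices, minimum spanning trees -/

/-- The right mixed product of `A` (over `ℝ ∪ {+∞}`) and the 0-1 matrix `B`:
`C[i,j] = min ({A[i,k] | B[k,j] = 1} ∪ {+∞})`. -/
noncomputable def rightProd {n : ℕ} (A : Matrix (Fin n) (Fin n) (WithTop ℝ))
    (B : Matrix (Fin n) (Fin n) Bool) : Matrix (Fin n) (Fin n) (WithTop ℝ) :=
  fun i j => (Finset.univ.filter fun k => B k j = true).inf fun k => A i k

/-- The left mixed product of the 0-1 matrix `B` and `A`: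
`C'[i,j] = min ({A[k,j] | B[i,k] = 1} ∪ {+∞})`. -/
noncomputable def leftProd {n : ℕ} (B : Matrix (Fin n) (Fin n) Bool)
    (A : Matrix (Fin n) (Fin n) (WithTop ℝ)) : Matrix (Fin n) (Fin n) (WithTop ℝ) :=
  fun i j => (Finset.univ.filter fun k => B i k = true).inf fun k => A k j

/-- `W` is a witness matrix for the right mixed product of `A` and `B`. Entries are natural
numbers; an entry that is a witness must be (the value of) an index `k : Fin n`. -/
def IsRightWitness {n : ℕ} (A : Matrix (Fin n) (Fin n) (WithTop ℝ))
    (B : Matrix (Fin n) (Fin n) Bool) (W : Matrix (Fin n) (Fin n) ℕ) : Prop :=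
  ∀ i j, rightProd A B i j ≠ ⊤ →
    ∃ k : Fin n, W i j = k ∧ B k j = true ∧ A i k = rightProd A B i j

/-- `W` is a witness matrix for the left mixed product of `B` and `A`. -/
def IsLeftWitness {n : ℕ} (B : Matrix (Fin n) (Fin n) Bool)
    (A : Matrix (Fin n) (Fin n) (WithTop ℝ)) (W : Matrix (Fin n) (Fin n) ℕ) : Prop :=
  ∀ i j, leftProd B A i j ≠ ⊤ →
    ∃ k : Fin n, W i j = k ∧ B i k = true ∧ A k j = leftProd B A i j

open Classical in
/-- Total weight of the edges of a graph. -/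
noncomputable def edgeWeight {V : Type*} [Fintype V] (w : Sym2 V → ℕ) (T : SimpleGraph V) : ℕ :=
  ∑ e ∈ T.edgeFinset, w e

/-- Weight of a minimum weight spanning tree of the graph `G` with edge weights `w`. -/
noncomputable def minSpanningTreeWeight {V : Type*} [Fintype V] (G : SimpleGraph V)
    (w : Sym2 V → ℕ) : ℕ :=
  sInf {m | ∃ T : SimpleGraph V, T ≤ G ∧ T.IsTree ∧ edgeWeight w T = m}

/-- The weight on the edges of the complete graph on the rows of `C`: the Hamming distance
of the two rows. -/
def rowDist {n : ℕ} (C : Matrix (Fin n) (Fin n) Bool) : Sym2 (Fin n) → ℕ :=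
  Sym2.lift ⟨fun i j => hammingDist (C i) (C j), fun i j => hammingDist_comm (C i) (C j)⟩

/-- `MWT(C)`: weight of a minimum weight spanning tree of the complete graph on the rows of `C`
weighted by Hamming distance. -/
noncomputable def MWT {n : ℕ} (C : Matrix (Fin n) (Fin n) Bool) : ℕ :=
  minSpanningTreeWeight (⊤ : SimpleGraph (Fin n)) (rowDist C)

/-! ### The machine model

A randomized random access machine with logarithmic cost, programmed in a structured language.
A program uses finitely many integer variables, integer arrays and real arrays (all named by
numerals). Integers can be added, subtracted (truncated at `0`), halved (rounding down) and
compared. Elements of `ℝ ∪ {+∞}` can only be copied and compared. There is a fair coin.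
Every integer that occurs in the evaluation of an expression is charged its bit length. -/

/-- Integer expressions. `read a e` is the cell of the integer array `a` at address `e`. -/
inductive Expr where
  | const (c : ℕ)
  | var (x : ℕ)
  | read (a : ℕ) (e : Expr)
  | add (e₁ e₂ : Expr)
  | sub (e₁ e₂ : Expr)
  | half (e : Expr)

/-- Tests. `rle a e₁ b e₂` compares the cell `e₁` of the real array `a` with the cell `e₂` of the
real array `b`. -/
inductive Test where
  | le (e₁ e₂ : Expr)
  | rle (a : ℕ) (e₁ : Expr) (b : ℕ) (e₂ : Expr)
  | not (b : Test)
  | and (b₁ b₂ : Test)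

/-- Programs.
* `assign x e`: variable `x` gets the value of `e`;
* `write a e₁ e₂`: cell `e₁` of the integer array `a` gets the value of `e₂`;
* `rcopy a e₁ b e₂`: cell `e₁` of the real array `a` gets the content of the cell `e₂` of the real
  array `b`;
* `rtop a e`: cell `e` of the real array `a` gets `+∞`;
* `flip x`: variable `x` gets a random bit. -/
inductive Prog where
  | skip
  | assign (x : ℕ) (e : Expr)
  | write (a : ℕ) (e₁ e₂ : Expr)
  | rcopy (a : ℕ) (e₁ : Expr) (b : ℕ) (e₂ : Expr)
  | rtop (a : ℕ) (e : Expr)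
  | flip (x : ℕ)
  | seq (p q : Prog)
  | ite (b : Test) (p q : Prog)
  | while (b : Test) (p : Prog)

/-- A state of the machine: integer variables, integer arrays, real arrays, and the number of
coins tossed so far. -/
structure State where
  var : ℕ → ℕ
  mem : ℕ → ℕ → ℕ
  rmem : ℕ → ℕ → WithTop ℝ
  pos : ℕ

/-- Value of an expression. -/
def Expr.eval (s : State) : Expr → ℕ
  | const c => c
  | var x => s.var x
  | read a e => s.mem a (e.eval s)
  | add e₁ e₂ => e₁.eval s + e₂.eval s
  | sub e₁ e₂ => e₁.eval s - e₂.eval s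
  | half e => e.eval s / 2

/-- Cost of evaluating an expression: every node of the expression costs one plus the bit length
of its value (so operands and addresses are charged as well). -/
def Expr.cost (s : State) : Expr → ℕ
  | const c => 1 + c.size
  | var x => 1 + (s.var x).size
  | read a e => e.cost s + 1 + (s.mem a (e.eval s)).size
  | add e₁ e₂ => e₁.cost s + e₂.cost s + 1 + (e₁.eval s + e₂.eval s).size
  | sub e₁ e₂ => e₁.cost s + e₂.cost s + 1 + (e₁.eval s - e₂.eval s).size
  | half e => e.cost s + 1 + (e.eval s / 2).size

/-- Truth of a test. -/
def Test.holds (s : State) : Test → Prop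
  | le e₁ e₂ => e₁.eval s ≤ e₂.eval s
  | rle a e₁ b e₂ => s.rmem a (e₁.eval s) ≤ s.rmem b (e₂.eval s)
  | not b => ¬ b.holds s
  | and b₁ b₂ => b₁.holds s ∧ b₂.holds s

/-- Cost of a test. -/
def Test.cost (s : State) : Test → ℕ
  | le e₁ e₂ => e₁.cost s + e₂.cost s + 1
  | rle _ e₁ _ e₂ => e₁.cost s + e₂.cost s + 1
  | not b => b.cost s + 1
  | and b₁ b₂ => b₁.cost s + b₂.cost s + 1

/-- Store `v` in variable `x`. -/
def State.setVar (s : State) (x v : ℕ) : State :=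
  { s with var := Function.update s.var x v }

/-- Store `v` in cell `i` of the integer array `a`. -/
def State.setMem (s : State) (a i v : ℕ) : State :=
  { s with mem := Function.update s.mem a (Function.update (s.mem a) i v) }

/-- Store `v` in cell `i` of the real array `a`. -/
def State.setReal (s : State) (a i : ℕ) (v : WithTop ℝ) : State :=
  { s with rmem := Function.update s.rmem a (Function.update (s.rmem a) i v) }

/-- `Exec ω p s t s'`: started in state `s`, with `ω i` the outcome of the `i`-th coin toss, the
program `p` halts in state `s'`, at total cost `t`. -/
inductive Exec (ω : ℕ → Bool) : Prog → State → ℕ → State → Prop where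
  | skip (s) : Exec ω .skip s 1 s
  | assign (s x e) : Exec ω (.assign x e) s (e.cost s + 1) (s.setVar x (e.eval s))
  | write (s a e₁ e₂) : Exec ω (.write a e₁ e₂) s (e₁.cost s + e₂.cost s + 1)
      (s.setMem a (e₁.eval s) (e₂.eval s))
  | rcopy (s a e₁ b e₂) : Exec ω (.rcopy a e₁ b e₂) s (e₁.cost s + e₂.cost s + 1)
      (s.setReal a (e₁.eval s) (s.rmem b (e₂.eval s)))
  | rtop (s a e) : Exec ω (.rtop a e) s (e.cost s + 1) (s.setReal a (e.eval s) ⊤)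
  | flip (s x) : Exec ω (.flip x) s 1
      { s.setVar x (ω s.pos).toNat with pos := s.pos + 1 }
  | seq {p q s s₁ s₂ t₁ t₂} : Exec ω p s t₁ s₁ → Exec ω q s₁ t₂ s₂ →
      Exec ω (.seq p q) s (t₁ + t₂) s₂
  | iteTrue {b p q s s' t} : b.holds s → Exec ω p s t s' →
      Exec ω (.ite b p q) s (b.cost s + 1 + t) s'
  | iteFalse {b p q s s' t} : ¬ b.holds s → Exec ω q s t s' →
      Exec ω (.ite b p q) s (b.cost s + 1 + t) s'
  | whileFalse {b p s} : ¬ b.holds s → Exec ω (.while b p) s (b.cost s + 1) s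
  | whileTrue {b p s s₁ s₂ t₁ t₂} : b.holds s → Exec ω p s t₁ s₁ →
      Exec ω (.while b p) s₁ t₂ s₂ →
      Exec ω (.while b p) s (b.cost s + 1 + t₁ + t₂) s₂

/-- For fixed coin tosses, the cost and the final state are determined by the program and the
initial state. -/
theorem Exec.deterministic {ω : ℕ → Bool} {p : Prog} {s s₁ s₂ : State} {t₁ t₂ : ℕ}
    (h₁ : Exec ω p s t₁ s₁) (h₂ : Exec ω p s t₂ s₂) : t₁ = t₂ ∧ s₁ = s₂ := by
  induction h₁ generalizing t₂ s₂ with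
  | seq _ _ ih₁ ih₂ =>
    cases h₂ with
    | seq a b =>
      obtain ⟨rfl, rfl⟩ := ih₁ a
      obtain ⟨rfl, rfl⟩ := ih₂ b
      exact ⟨rfl, rfl⟩
  | iteTrue hb _ ih =>
    cases h₂ with
    | iteTrue _ a => obtain ⟨rfl, rfl⟩ := ih a; exact ⟨rfl, rfl⟩
    | iteFalse hb' _ => exact absurd hb hb'
  | iteFalse hb _ ih =>
    cases h₂ with
    | iteFalse _ a => obtain ⟨rfl, rfl⟩ := ih a; exact ⟨rfl, rfl⟩
    | iteTrue hb' _ => exact absurd hb' hb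
  | whileFalse hb =>
    cases h₂ with
    | whileFalse _ => exact ⟨rfl, rfl⟩
    | whileTrue hb' _ _ => exact absurd hb' hb
  | whileTrue hb _ _ ih₁ ih₂ =>
    cases h₂ with
    | whileFalse hb' => exact absurd hb hb'
    | whileTrue _ a b =>
      obtain ⟨rfl, rfl⟩ := ih₁ a
      obtain ⟨rfl, rfl⟩ := ih₂ b
      exact ⟨rfl, rfl⟩
  | _ => cases h₂; exact ⟨rfl, rfl⟩

/-- The law of an infinite sequence of independent fair coin tosses. -/
noncomputable def coinMeasure : Measure (ℕ → Bool) :=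
  Measure.infinitePi fun _ => (PMF.uniformOfFintype Bool).toMeasure

instance : IsProbabilityMeasure coinMeasure := by
  unfold coinMeasure; infer_instance

/-! ### Inputs and outputs -/

/-- An `n × n` matrix stored row by row in an array, with `d` in all other cells: entry `(i,j)` is
in cell `i * n + j`. -/
def layout {n : ℕ} {R : Type*} (M : Matrix (Fin n) (Fin n) R) (d : R) (c : ℕ) : R :=
  if h : c < n * n then M (Fin.divNat ⟨c, h⟩) (Fin.modNat ⟨c, h⟩) else d

/-- The initial state on input `A`, `B`: variable `0` holds `n`, the integer array `0` holds `B`,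
the real array `0` holds `A`; all other variables and integer cells hold `0`, all other real cells
hold `+∞`. -/
noncomputable def initState {n : ℕ} (A : Matrix (Fin n) (Fin n) (WithTop ℝ))
    (B : Matrix (Fin n) (Fin n) Bool) : State where
  var := fun x => if x = 0 then n else 0
  mem := fun a => if a = 0 then layout (B.map Bool.toNat) 0 else fun _ => 0
  rmem := fun a => if a = 0 then layout A ⊤ else fun _ => ⊤
  pos := 0

/-- The first output: the `n × n` matrix in the real array `1`. -/
def State.outReal (s : State) (n : ℕ) : Matrix (Fin n) (Fin n) (WithTop ℝ) :=
  fun i j => s.rmem 1 (i * n + j)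

/-- The second output: the `n × n` matrix in the integer array `1`. -/
def State.outNat (s : State) (n : ℕ) : Matrix (Fin n) (Fin n) ℕ :=
  fun i j => s.mem 1 (i * n + j)

/-- The event that the program `p`, started on input `A`, `B`, halts at cost at most `T` with an
output `(C, W)` that satisfies `Q`. -/
def successEvent (p : Prog) {n : ℕ} (A : Matrix (Fin n) (Fin n) (WithTop ℝ))
    (B : Matrix (Fin n) (Fin n) Bool) (T : ℝ)
    (Q : Matrix (Fin n) (Fin n) (WithTop ℝ) → Matrix (Fin n) (Fin n) ℕ → Prop) :
    Set (ℕ → Bool) :=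
  {ω | ∃ (t : ℕ) (s : State), Exec ω p (initState A B) t s ∧ (t : ℝ) ≤ T ∧
    Q (s.outReal n) (s.outNat n)}

end MixedProduct

namespace MixedProduct

/-! ### Cost bounds for loop-free code -/

/-! The algorithm is deterministic, so the success event is the whole probability space and only
correctness and running time matter. For the right product, consider the columns of `B`, that is,
the rows of `Bᵀ`. Let `N = 2 ^ L` be the least power of two with `n ≤ N`. Each column becomes a
complete binary tree with `N` leaves, stored as a heap; leaf `k` is labelled `k + 1` if the column
has a one in position `k`, and `0` otherwise. Equal subtrees, in one column or in different ones,
share one integer name, found by looking up the pair of names of the children in a directly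
addressed table. A row of `A` is then processed by computing, for every name in increasing order,
the minimum over the positions it contains, with a witness, from the two children. The entries of
the product are the values at the names of the roots.

The time is governed by the number of distinct trees. At a fixed heap vertex, the columns show at
most one more subtree than there are edges of a minimum spanning tree along which the subtree
changes (`card_image_le_of_connected`). The subtree changes along an edge only if the vertex lies
above a position where the two columns differ, and each such position has `L + 1` ancestors, itself
included. Summing over vertices and exchanging sums gives at most `2 * N + (L + 1) * MWT` trees
(`card_allTrees_le_MWT`). Naming costs `O(n * N)` steps and each row costs time linear in `n` plus
the number of names, hence `Õ(n * (n + MWT))` in total. All integers are polynomial in `n`, so the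
logarithmic cost adds one factor `log n`.

The left product is the same computation with all matrices transposed. Correctness is carried by the
dictionary invariant `NameTable`, by `runs_combine` (naming) and by `runs_minStep` (minima). -/

/-- Number of nodes of an expression. -/
def Expr.nodes : Expr → ℕ
  | const _ => 1
  | var _ => 1
  | read _ e => e.nodes + 1
  | add e₁ e₂ => e₁.nodes + e₂.nodes + 1
  | sub e₁ e₂ => e₁.nodes + e₂.nodes + 1
  | half e => e.nodes + 1

/-- Every integer that occurs in the evaluation of the expression is at most `V`. -/
def Expr.Bounded (V : ℕ) (s : State) : Expr → Prop
  | const c => c ≤ V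
  | var x => s.var x ≤ V
  | read a e => e.Bounded V s ∧ s.mem a (e.eval s) ≤ V
  | add e₁ e₂ => e₁.Bounded V s ∧ e₂.Bounded V s ∧ e₁.eval s + e₂.eval s ≤ V
  | sub e₁ e₂ => e₁.Bounded V s ∧ e₂.Bounded V s
  | half e => e.Bounded V s

theorem Expr.Bounded.eval_le {V : ℕ} {s : State} {e : Expr} (h : e.Bounded V s) :
    e.eval s ≤ V := by
  induction e with
  | const c => exact h
  | var x => exact h
  | read a e _ => exact h.2
  | add e₁ e₂ _ _ => exact h.2.2
  | sub e₁ e₂ ih _ => exact (Nat.sub_le _ _).trans (ih h.1)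
  | half e ih => exact (Nat.div_le_self _ _).trans (ih h)

theorem Expr.Bounded.cost_le {V : ℕ} {s : State} {e : Expr} (h : e.Bounded V s) :
    e.cost s ≤ e.nodes * (V.size + 1) := by
  induction e with
  | const c =>
    have := Nat.size_le_size (show c ≤ V from h)
    simp only [Expr.cost, Expr.nodes]; omega
  | var x =>
    have := Nat.size_le_size (show s.var x ≤ V from h)
    simp only [Expr.cost, Expr.nodes]; omega
  | read a e ih =>
    have := Nat.size_le_size h.2
    have := ih h.1
    simp only [Expr.cost, Expr.nodes, add_mul]; omega
  | add e₁ e₂ ih₁ ih₂ =>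
    have := Nat.size_le_size h.2.2
    have := ih₁ h.1
    have := ih₂ h.2.1
    simp only [Expr.cost, Expr.nodes, add_mul]; omega
  | sub e₁ e₂ ih₁ ih₂ =>
    have := Nat.size_le_size ((Nat.sub_le _ (e₂.eval s)).trans h.1.eval_le)
    have := ih₁ h.1
    have := ih₂ h.2
    simp only [Expr.cost, Expr.nodes, add_mul]; omega
  | half e ih =>
    have := Nat.size_le_size ((Nat.div_le_self _ 2).trans (Expr.Bounded.eval_le (e := e) h))
    have := ih h
    simp only [Expr.cost, Expr.nodes, add_mul]; omega

/-- Number of nodes of a test. -/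
def Test.nodes : Test → ℕ
  | le e₁ e₂ => e₁.nodes + e₂.nodes + 1
  | rle _ e₁ _ e₂ => e₁.nodes + e₂.nodes + 1
  | not b => b.nodes + 1
  | and b₁ b₂ => b₁.nodes + b₂.nodes + 1

/-- Every integer that occurs in the evaluation of the test is at most `V`. -/
def Test.Bounded (V : ℕ) (s : State) : Test → Prop
  | le e₁ e₂ => e₁.Bounded V s ∧ e₂.Bounded V s
  | rle _ e₁ _ e₂ => e₁.Bounded V s ∧ e₂.Bounded V s
  | not b => b.Bounded V s
  | and b₁ b₂ => b₁.Bounded V s ∧ b₂.Bounded V s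

theorem Test.Bounded.cost_le {V : ℕ} {s : State} {b : Test} (h : b.Bounded V s) :
    b.cost s ≤ b.nodes * (V.size + 1) := by
  induction b with
  | le e₁ e₂ =>
    have := h.1.cost_le
    have := h.2.cost_le
    simp only [Test.cost, Test.nodes, add_mul]; omega
  | rle _ e₁ _ e₂ =>
    have := h.1.cost_le
    have := h.2.cost_le
    simp only [Test.cost, Test.nodes, add_mul]; omega
  | not b ih =>
    have := ih h
    simp only [Test.cost, Test.nodes, add_mul]; omega
  | and b₁ b₂ ih₁ ih₂ =>
    have := ih₁ h.1
    have := ih₂ h.2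
    simp only [Test.cost, Test.nodes, add_mul]; omega

/-- Number of nodes of a program. -/
def Prog.nodes : Prog → ℕ
  | skip => 1
  | assign _ e => e.nodes + 1
  | write _ e₁ e₂ => e₁.nodes + e₂.nodes + 1
  | rcopy _ e₁ _ e₂ => e₁.nodes + e₂.nodes + 1
  | rtop _ e => e.nodes + 1
  | flip _ => 1
  | seq p q => p.nodes + q.nodes
  | ite b p q => b.nodes + 1 + p.nodes + q.nodes
  | .while b p => b.nodes + 1 + p.nodes

/-- Weakest precondition of a deterministic loop-free program for the postcondition `Q` and all
integers that occur being at most `V`. -/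
def Prog.wp (V : ℕ) : Prog → State → (State → Prop) → Prop
  | skip, s, Q => Q s
  | assign x e, s, Q => e.Bounded V s ∧ Q (s.setVar x (e.eval s))
  | write a e₁ e₂, s, Q => e₁.Bounded V s ∧ e₂.Bounded V s ∧
      Q (s.setMem a (e₁.eval s) (e₂.eval s))
  | rcopy a e₁ b e₂, s, Q => e₁.Bounded V s ∧ e₂.Bounded V s ∧
      Q (s.setReal a (e₁.eval s) (s.rmem b (e₂.eval s)))
  | rtop a e, s, Q => e.Bounded V s ∧ Q (s.setReal a (e.eval s) ⊤)
  | flip _, _, _ => False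
  | seq p q, s, Q => p.wp V s fun s' => q.wp V s' Q
  | ite b p q, s, Q => b.Bounded V s ∧ (b.holds s → p.wp V s Q) ∧ (¬ b.holds s → q.wp V s Q)
  | .while _ _, _, _ => False

/-- Started in `s`, the program halts in a state satisfying `Q`, at a cost of at most `T` times
the maximal cost `V.size + 1` of handling one integer `≤ V`. -/
def Runs (ω : ℕ → Bool) (V : ℕ) (p : Prog) (s : State) (T : ℕ) (Q : State → Prop) : Prop :=
  ∃ t s', Exec ω p s t s' ∧ t ≤ T * (V.size + 1) ∧ Q s'

variable {ω : ℕ → Bool} {V : ℕ}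

theorem Runs.mono {p : Prog} {s : State} {T T' : ℕ} {Q Q' : State → Prop}
    (h : Runs ω V p s T Q) (hT : T ≤ T') (hQ : ∀ s, Q s → Q' s) : Runs ω V p s T' Q' := by
  obtain ⟨t, s', he, ht, hq⟩ := h
  exact ⟨t, s', he, ht.trans (Nat.mul_le_mul_right _ hT), hQ _ hq⟩

theorem Runs.seq {p q : Prog} {s : State} {T₁ T₂ : ℕ} {Q R : State → Prop}
    (h₁ : Runs ω V p s T₁ R) (h₂ : ∀ s, R s → Runs ω V q s T₂ Q) :
    Runs ω V (.seq p q) s (T₁ + T₂) Q := by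
  obtain ⟨t, s', he, ht, hq⟩ := h₁
  obtain ⟨t', s'', he', ht', hq'⟩ := h₂ s' hq
  exact ⟨t + t', s'', .seq he he', by rw [add_mul]; omega, hq'⟩

/-- Every node evaluated handles one integer at most `V`, so the syntactic size bounds the cost;
both branches of a conditional are counted. This reduces straight-line code to arithmetic side
goals, while loops go through `Runs.loop`. -/
theorem Runs.of_wp {p : Prog} {s : State} {Q : State → Prop} (h : p.wp V s Q) :
    Runs ω V p s p.nodes Q := by
  induction p generalizing s Q with
  | skip => exact ⟨1, s, .skip s, by simp [Prog.nodes], h⟩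
  | assign x e =>
    have := h.1.cost_le
    exact ⟨_, _, .assign s x e, by simp only [Prog.nodes, add_mul]; omega, h.2⟩
  | write a e₁ e₂ =>
    have := h.1.cost_le
    have := h.2.1.cost_le
    exact ⟨_, _, .write s a e₁ e₂, by simp only [Prog.nodes, add_mul]; omega, h.2.2⟩
  | rcopy a e₁ b e₂ =>
    have := h.1.cost_le
    have := h.2.1.cost_le
    exact ⟨_, _, .rcopy s a e₁ b e₂, by simp only [Prog.nodes, add_mul]; omega, h.2.2⟩
  | rtop a e =>
    have := h.1.cost_le
    exact ⟨_, _, .rtop s a e, by simp only [Prog.nodes, add_mul]; omega, h.2⟩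
  | seq p q ihp ihq => exact (ihp h).seq fun _ hs => ihq hs
  | ite b p q ihp ihq =>
    have hc := h.1.cost_le
    by_cases hb : b.holds s
    · obtain ⟨t, s', he, ht, hq⟩ := ihp (h.2.1 hb)
      exact ⟨_, s', .iteTrue hb he, by simp only [Prog.nodes, add_mul]; omega, hq⟩
    · obtain ⟨t, s', he, ht, hq⟩ := ihq (h.2.2 hb)
      exact ⟨_, s', .iteFalse hb he, by simp only [Prog.nodes, add_mul]; omega, hq⟩
  | _ => exact h.elim

/-! ### Loops -/

/-- A loop that is executed `m` times, with invariant `I`. -/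
theorem Runs.loop {b : Test} {p : Prog} {m D : ℕ} {I : ℕ → State → Prop}
    (hstep : ∀ i < m, ∀ s, I i s → b.Bounded V s ∧ b.holds s ∧ Runs ω V p s D (I (i + 1)))
    (hfinal : ∀ s, I m s → b.Bounded V s ∧ ¬ b.holds s) (s : State) (hs : I 0 s) :
    Runs ω V (.while b p) s (m * (b.nodes + 1 + D) + (b.nodes + 1)) (I m) := by
  -- The induction is on the number `r` of remaining iterations.
  suffices H : ∀ r i, i + r = m → ∀ s, I i s →
      Runs ω V (.while b p) s (r * (b.nodes + 1 + D) + (b.nodes + 1)) (I m) from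
    H m 0 (Nat.zero_add m) s hs
  intro r
  induction r with
  | zero =>
    intro i hi s hs
    obtain rfl : i = m := by omega
    have hc := (hfinal s hs).1.cost_le
    exact ⟨_, s, .whileFalse (hfinal s hs).2, by
      simp only [zero_mul, zero_add, add_mul]; omega, hs⟩
  | succ r ih =>
    intro i hi s hs
    obtain ⟨hb, hh, t₁, s₁, he, ht, hi₁⟩ := hstep i (by omega) s hs
    obtain ⟨t₂, s₂, he₂, ht₂, hq⟩ := ih (i + 1) (by omega) s₁ hi₁
    have hc := hb.cost_le
    refine ⟨_, s₂, .whileTrue hh he he₂, ?_, hq⟩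
    calc b.cost s + 1 + t₁ + t₂ ≤ (b.nodes + 1 + D) * (V.size + 1) +
          (r * (b.nodes + 1 + D) + (b.nodes + 1)) * (V.size + 1) := by
            simp only [add_mul] at *; omega
      _ = _ := by ring

/-! ### Reading a state after an update, and counted loops. -/

@[simp] theorem State.setVar_var (s : State) (x v y : ℕ) :
    (s.setVar x v).var y = if y = x then v else s.var y := by
  simp [State.setVar, Function.update_apply]

@[simp] theorem State.setVar_mem (s : State) (x v : ℕ) : (s.setVar x v).mem = s.mem := rfl

@[simp] theorem State.setVar_rmem (s : State) (x v : ℕ) : (s.setVar x v).rmem = s.rmem := rfl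

@[simp] theorem State.setMem_var (s : State) (a i v : ℕ) : (s.setMem a i v).var = s.var := rfl

@[simp] theorem State.setMem_mem (s : State) (a i v b : ℕ) :
    (s.setMem a i v).mem b = if b = a then Function.update (s.mem b) i v else s.mem b := by
  by_cases h : b = a
  · subst h; simp [State.setMem]
  · simp [State.setMem, h]

@[simp] theorem State.setMem_rmem (s : State) (a i v : ℕ) : (s.setMem a i v).rmem = s.rmem := rfl

@[simp] theorem State.setReal_var (s : State) (a i : ℕ) (v : WithTop ℝ) :
    (s.setReal a i v).var = s.var := rfl

@[simp] theorem State.setReal_mem (s : State) (a i : ℕ) (v : WithTop ℝ) :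
    (s.setReal a i v).mem = s.mem := rfl

@[simp] theorem State.setReal_rmem (s : State) (a i : ℕ) (v : WithTop ℝ) (b : ℕ) :
    (s.setReal a i v).rmem b = if b = a then Function.update (s.rmem b) i v else s.rmem b := by
  by_cases h : b = a
  · subst h; simp [State.setReal]
  · simp [State.setReal, h]

/-- `for x = 0, …, n - 1 do p`, where `n` is in variable `0`; variable `y` holds `x * n`. -/
def forLoop (x y : ℕ) (p : Prog) : Prog :=
  .seq (.assign x (.const 0)) <| .seq (.assign y (.const 0)) <|
    .while (.le (.add (.var x) (.const 1)) (.var 0)) <|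
      .seq p <| .seq (.assign x (.add (.var x) (.const 1))) (.assign y (.add (.var y) (.var 0)))

/-- The machine cannot multiply, so `y` follows `x * n` by repeated addition. The invariant `J` must
not depend on the two counters; the facts about them are maintained here. Each round adds 6 for the
test and 8 for the increments. -/
theorem Runs.forLoop {x y n D : ℕ} {p : Prog} {J : ℕ → State → Prop} (hx : x ≠ 0) (hy : y ≠ 0)
    (hxy : x ≠ y) (hV : n * n ≤ V) (hn : n < V)
    (hJx : ∀ i s v, J i s → J i (s.setVar x v)) (hJy : ∀ i s v, J i s → J i (s.setVar y v))
    (hstep : ∀ i < n, ∀ s, s.var 0 = n → s.var x = i → s.var y = i * n → J i s →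
      Runs ω V p s D fun s' => s'.var 0 = n ∧ s'.var x = i ∧ s'.var y = i * n ∧ J (i + 1) s')
    {s : State} (h0 : s.var 0 = n) (hs : J 0 s) :
    Runs ω V (forLoop x y p) s (n * (D + 14) + 10) fun s' => s'.var 0 = n ∧ J n s' := by
  have key := Runs.loop (ω := ω) (V := V) (m := n) (D := D + 8)
    (b := .le (.add (.var x) (.const 1)) (.var 0))
    (p := .seq p <| .seq (.assign x (.add (.var x) (.const 1)))
      (.assign y (.add (.var y) (.var 0))))
    (I := fun i s => s.var 0 = n ∧ s.var x = i ∧ s.var y = i * n ∧ J i s)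
    (by
      rintro i hi s ⟨h0, h1, h2, h3⟩
      refine ⟨?_, ?_, ?_⟩
      · simp only [Test.Bounded, Expr.Bounded, Expr.eval, h0, h1]; omega
      · simp only [Test.holds, Expr.eval, h0, h1]; omega
      · refine (hstep i hi s h0 h1 h2 h3).seq (T₂ := 8) fun s' ⟨h0, h1, h2, h3⟩ => ?_
        refine Runs.of_wp ?_
        have hle : i * n + n ≤ n * n := by
          calc i * n + n = (i + 1) * n := by ring
            _ ≤ _ := Nat.mul_le_mul_right _ hi
        simp only [Prog.wp, Expr.Bounded, Expr.eval, State.setVar_var, h0, h1, h2, hx.symm,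
          hy.symm, hxy, hxy.symm, if_true, if_false]
        refine ⟨by omega, by omega, trivial, trivial, by ring, hJy _ _ _ (hJx _ _ _ h3)⟩)
    (by
      rintro s ⟨h0, h1, h2, h3⟩
      constructor
      · simp only [Test.Bounded, Expr.Bounded, Expr.eval, h0, h1]; omega
      · simp only [Test.holds, Expr.eval, h0, h1]; omega)
  refine Runs.mono (Runs.seq (T₁ := 2) (R := fun s => s.var 0 = n ∧ s.var x = 0 ∧ J 0 s)
    (Runs.of_wp ?_) fun s ⟨h0, h1, h2⟩ => Runs.seq (T₁ := 2) (Runs.of_wp ?_) fun s hs => key s hs)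
    ?_ ?_
  · simp only [Prog.wp, Expr.Bounded, Expr.eval, State.setVar_var, hx.symm, if_true, if_false]
    exact ⟨Nat.zero_le _, h0, trivial, hJx _ _ _ hs⟩
  · simp only [Prog.wp, Expr.Bounded, Expr.eval, State.setVar_var, hy.symm, hxy, if_true, if_false]
    exact ⟨Nat.zero_le _, h0, h1, by simp, hJy _ _ _ h2⟩
  · simp only [Test.nodes, Expr.nodes]
    exact le_of_eq (by ring)
  · rintro s ⟨h0, -, -, h3⟩; exact ⟨h0, h3⟩


/-! ### Distinct values along a connected graph -/

open Classical in
/-- A function on the vertices of a connected graph takes at most one more value than there are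
edges along which it changes. -/
theorem card_image_le_of_connected {V X : Type*} [Fintype V] {G : SimpleGraph V}
    (hG : G.Connected) (f : V → X) :
    (Finset.univ.image f).card ≤ 1 + (G.edgeFinset.filter fun e => ¬ (e.map f).IsDiag).card := by
  -- The image of `G` under `f`, with loops discarded. It is connected because `G` is, so it has at
  -- least `card - 1` edges.
  let H : SimpleGraph (Set.range f) :=
    { Adj := fun a b => a ≠ b ∧ ∃ u v, G.Adj u v ∧ f u = a ∧ f v = b
      symm := ⟨fun a b ⟨h, u, v, huv, hu, hv⟩ => ⟨h.symm, v, u, huv.symm, hv, hu⟩⟩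
      loopless := ⟨fun a h => h.1 rfl⟩ }
  have hreach : ∀ u v, H.Reachable ⟨f u, u, rfl⟩ ⟨f v, v, rfl⟩ := by
    intro u v
    have huv := (SimpleGraph.reachable_iff_reflTransGen u v).1 (hG.preconnected u v)
    induction huv with
    | refl => exact SimpleGraph.Reachable.refl _
    | @tail b c _ hbc ih =>
      by_cases h : f b = f c
      · rwa [show (⟨f c, c, rfl⟩ : Set.range f) = ⟨f b, b, rfl⟩ from Subtype.ext h.symm]
      · exact ih.trans (SimpleGraph.Adj.reachable ⟨fun e => h (congrArg Subtype.val e),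
          b, c, hbc, rfl, rfl⟩)
  have hne : Nonempty (Set.range f) := by
    obtain ⟨v⟩ := hG.nonempty
    exact ⟨⟨f v, v, rfl⟩⟩
  have hconn : H.Connected := by
    refine SimpleGraph.Connected.mk ?_
    rintro ⟨_, u, rfl⟩ ⟨_, v, rfl⟩
    exact hreach u v
  have h1 := hconn.card_vert_le_card_edgeSet_add_one
  have h2 : (Finset.univ.image f).card = Nat.card (Set.range f) := by
    rw [Nat.card_coe_set_eq, ← Set.ncard_coe_finset]
    simp
  -- Each edge of `H` is the image of an edge of `G` along which `f` changes.
  have h3 : Nat.card H.edgeSet ≤ (G.edgeFinset.filter fun e => ¬ (e.map f).IsDiag).card := by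
    rw [Nat.card_coe_set_eq, ← Set.ncard_image_of_injective _
      (Sym2.map.injective (Subtype.val_injective (p := (· ∈ Set.range f)))), ← Set.ncard_coe_finset]
    refine le_trans (Set.ncard_le_ncard (t := Sym2.map f '' _) ?_ ((Finset.finite_toSet _).image _))
      (Set.ncard_image_le (Finset.finite_toSet _))
    rintro _ ⟨e, he, rfl⟩
    induction e with
    | _ a b =>
      obtain ⟨hab, u, v, huv, hu, hv⟩ := he
      refine ⟨s(u, v), ?_, by simp [hu, hv]⟩
      simp only [Finset.coe_filter, Set.mem_ofPred_eq, SimpleGraph.mem_edgeFinset,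
        SimpleGraph.mem_edgeSet, huv, true_and, Sym2.map_mk, Sym2.mk_isDiag_iff, hu, hv]
      exact fun e => hab (Subtype.ext e)
  omega

/-! ### Trees over the positions -/

/-- Binary trees with labelled leaves. -/
inductive BTree where
  | leaf (k : ℕ)
  | node (l r : BTree)

/-- The set of all `k` such that `k + 1` is the label of a leaf. -/
def BTree.ones : BTree → Finset ℕ
  | leaf 0 => ∅
  | leaf (k + 1) => {k}
  | node l r => l.ones ∪ r.ones

/-- The tree rooted at vertex `h` of the binary heap with the leaves `N, …, 2 * N - 1`; the leaf
`N + k` has the label `lf k`. -/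
def heapTree (N : ℕ) (lf : ℕ → ℕ) (h : ℕ) : BTree :=
  if h = 0 ∨ N ≤ h then .leaf (lf (h - N))
  else .node (heapTree N lf (2 * h)) (heapTree N lf (2 * h + 1))
termination_by N - h

theorem heapTree_of_le {N : ℕ} (lf : ℕ → ℕ) {h : ℕ} (hN : N ≤ h) :
    heapTree N lf h = .leaf (lf (h - N)) := by
  rw [heapTree, if_pos (Or.inr hN)]

theorem heapTree_of_lt {N : ℕ} (lf : ℕ → ℕ) {h : ℕ} (h0 : h ≠ 0) (hN : h < N) :
    heapTree N lf h = .node (heapTree N lf (2 * h)) (heapTree N lf (2 * h + 1)) := by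
  rw [heapTree, if_neg (by omega)]

/-- The ancestors of `c` in a heap are the numbers `c / 2 ^ i`. Since `h < N ≤ c`, an ancestor `h`
is proper, and the path from `c` reaches it through one of its two children. -/
theorem exists_div_pow_eq_iff {N c h : ℕ} (hc : N ≤ c) (hN : h < N) :
    (∃ i, c / 2 ^ i = h) ↔ (∃ i, c / 2 ^ i = 2 * h) ∨ ∃ i, c / 2 ^ i = 2 * h + 1 := by
  constructor
  · rintro ⟨_ | i, hi⟩
    · simp at hi; omega
    · rw [pow_succ, ← Nat.div_div_eq_div_mul] at hi
      rcases Nat.mod_two_eq_zero_or_one (c / 2 ^ i) with h | h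
      · exact .inl ⟨i, by omega⟩
      · exact .inr ⟨i, by omega⟩
  · rintro (⟨i, hi⟩ | ⟨i, hi⟩) <;>
    exact ⟨i + 1, by rw [pow_succ, ← Nat.div_div_eq_div_mul]; omega⟩

/-- Two heaps can differ only at the ancestors of leaves at which they differ. -/
theorem exists_leaf_ne_of_heapTree_ne {N : ℕ} {lf lf' : ℕ → ℕ} {h : ℕ} (h0 : h ≠ 0)
    (hh : h < 2 * N) (hne : heapTree N lf h ≠ heapTree N lf' h) :
    ∃ k < N, lf k ≠ lf' k ∧ ∃ i, (N + k) / 2 ^ i = h := by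
  by_cases hN : N ≤ h
  · rw [heapTree_of_le _ hN, heapTree_of_le _ hN] at hne
    refine ⟨h - N, by omega, fun e => hne (by rw [e]), 0, ?_⟩
    simp; omega
  · have hN : h < N := by omega
    rw [heapTree_of_lt _ h0 hN, heapTree_of_lt _ h0 hN] at hne
    by_cases hl : heapTree N lf (2 * h) = heapTree N lf' (2 * h)
    · obtain ⟨k, hk, hlf, hi⟩ := exists_leaf_ne_of_heapTree_ne (N := N) (h := 2 * h + 1) (by omega)
        (by omega) (fun hr => hne (by rw [hl, hr]))
      exact ⟨k, hk, hlf, (exists_div_pow_eq_iff (by omega) hN).2 (.inr hi)⟩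
    · obtain ⟨k, hk, hlf, hi⟩ := exists_leaf_ne_of_heapTree_ne (N := N) (h := 2 * h) (by omega)
        (by omega) hl
      exact ⟨k, hk, hlf, (exists_div_pow_eq_iff (by omega) hN).2 (.inl hi)⟩
termination_by N - h

theorem mem_ones_heapTree {N : ℕ} {lf : ℕ → ℕ} (hlf : ∀ k, lf k = 0 ∨ lf k = k + 1) {h : ℕ}
    (h0 : h ≠ 0) (hh : h < 2 * N) (k : ℕ) :
    k ∈ (heapTree N lf h).ones ↔ k < N ∧ lf k ≠ 0 ∧ ∃ i, (N + k) / 2 ^ i = h := by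
  by_cases hN : N ≤ h
  · rw [heapTree_of_le _ hN]
    have hleaf : k ∈ (BTree.leaf (lf (h - N))).ones ↔ lf (h - N) ≠ 0 ∧ k = h - N := by
      rcases hlf (h - N) with e | e <;> simp [e, BTree.ones]
    rw [hleaf]
    constructor
    · rintro ⟨h1, rfl⟩
      exact ⟨by omega, h1, 0, by simp; omega⟩
    · rintro ⟨h1, h2, i, hi⟩
      have : k = h - N := by
        rcases i with _ | i
        · simp at hi; omega
        · rw [pow_succ', ← Nat.div_div_eq_div_mul] at hi
          have := Nat.div_le_self ((N + k) / 2) (2 ^ i)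
          omega
      exact ⟨this ▸ h2, this⟩
  · have hN : h < N := by omega
    rw [heapTree_of_lt _ h0 hN, BTree.ones, Finset.mem_union,
      mem_ones_heapTree hlf (by omega) (by omega), mem_ones_heapTree hlf (by omega) (by omega),
      exists_div_pow_eq_iff (by omega) hN]
    tauto
termination_by N - h

/-- With `2 ^ L` leaves, every leaf reaches the root after exactly `L` halvings. -/
theorem mem_ones_heapTree_one {L : ℕ} {lf : ℕ → ℕ} (hlf : ∀ k, lf k = 0 ∨ lf k = k + 1)
    (k : ℕ) : k ∈ (heapTree (2 ^ L) lf 1).ones ↔ k < 2 ^ L ∧ lf k ≠ 0 := by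
  have hL : 0 < 2 ^ L := by positivity
  rw [mem_ones_heapTree hlf one_ne_zero (by omega)]
  refine ⟨fun h => ⟨h.1, h.2.1⟩, fun h => ⟨h.1, h.2, L, ?_⟩⟩
  rw [Nat.add_div_left _ hL, Nat.div_eq_of_lt h.1, zero_add]

open Classical in
/-- The trees that occur in the heaps of the columns `0, …, n - 1`. -/
noncomputable def allTrees (n N : ℕ) (lf : ℕ → ℕ → ℕ) : Finset BTree :=
  (Finset.range n ×ˢ Finset.Ico 1 (2 * N)).image fun p => heapTree N (lf p.1) p.2

theorem heapTree_mem_allTrees {n N : ℕ} {lf : ℕ → ℕ → ℕ} {j h : ℕ} (hj : j < n) (h0 : h ≠ 0)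
    (hN : h < 2 * N) : heapTree N (lf j) h ∈ allTrees n N lf := by
  classical
  exact Finset.mem_image_of_mem (fun p : ℕ × ℕ => heapTree N (lf p.1) p.2)
    (a := (j, h)) (by simp; omega)

/-- This crude bound is independent of the spanning tree; it allows the base `K` of the table to be
fixed before the trees are known. -/
theorem card_allTrees_le_mul (n N : ℕ) (lf : ℕ → ℕ → ℕ) :
    (allTrees n N lf).card ≤ n * (2 * N) := by
  classical
  refine Finset.card_image_le.trans ?_
  rw [Finset.card_product, Finset.card_range, Nat.card_Ico]
  exact Nat.mul_le_mul_left _ (Nat.sub_le _ _)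

/-! ### Counting distinct trees by a minimum spanning tree. -/

theorem exists_isTree_edgeWeight_eq_MWT {n : ℕ} (hn : 1 ≤ n) (M : Matrix (Fin n) (Fin n) Bool) :
    ∃ T : SimpleGraph (Fin n), T.IsTree ∧ edgeWeight (rowDist M) T = MWT M := by
  have : Nonempty (Fin n) := ⟨⟨0, hn⟩⟩
  obtain ⟨T₀, hle, hT₀⟩ := (SimpleGraph.connected_top (V := Fin n)).exists_isTree_le
  obtain ⟨T, -, hT, h⟩ := Nat.sInf_mem (s := {m | ∃ T : SimpleGraph (Fin n), T ≤ ⊤ ∧ T.IsTree ∧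
    edgeWeight (rowDist M) T = m}) ⟨_, T₀, hle, hT₀, rfl⟩
  exact ⟨T, hT, h⟩

/-- The number of different trees is almost linear in the weight of a minimum spanning tree. -/
theorem card_allTrees_le_MWT {n L : ℕ} (hn : 1 ≤ n) (M : Matrix (Fin n) (Fin n) Bool)
    (lf : ℕ → ℕ → ℕ)
    (hlf : ∀ (j j' : Fin n) (k : ℕ), lf j k ≠ lf j' k → ∃ hk : k < n, M j ⟨k, hk⟩ ≠ M j' ⟨k, hk⟩) :
    (allTrees n (2 ^ L) lf).card ≤ 2 * 2 ^ L + (L + 1) * MWT M := by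
  classical
  obtain ⟨T, hT, hW⟩ := exists_isTree_edgeWeight_eq_MWT hn M
  set N := 2 ^ L with hN
  let f : ℕ → Fin n → BTree := fun h j => heapTree N (lf j) h
  have hsub : allTrees n N lf ⊆
      (Finset.Ico 1 (2 * N)).biUnion fun h => Finset.univ.image (f h) := by
    intro t ht
    obtain ⟨⟨j, h⟩, hp, rfl⟩ := Finset.mem_image.1 ht
    rw [Finset.mem_product, Finset.mem_range] at hp
    exact Finset.mem_biUnion.2 ⟨h, hp.2, Finset.mem_image.2 ⟨⟨j, hp.1⟩, Finset.mem_univ _, rfl⟩⟩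
  -- A vertex where the two heaps differ is the `i`-th ancestor of a leaf `k` where the rows differ;
  -- the pairs `(i, k)` number `L + 1` times the Hamming distance.
  have hedge : ∀ e : Sym2 (Fin n),
      ((Finset.Ico 1 (2 * N)).filter fun h => ¬ (e.map (f h)).IsDiag).card ≤
        (L + 1) * rowDist M e := by
    intro e
    induction e with
    | _ a b =>
      have : ((Finset.Ico 1 (2 * N)).filter fun h => ¬ ((s(a, b) : Sym2 (Fin n)).map (f h)).IsDiag)
          ⊆ (Finset.range (L + 1) ×ˢ Finset.univ.filter fun k => M a k ≠ M b k).image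
            fun p => (N + (p.2 : ℕ)) / 2 ^ p.1 := by
        intro h hh
        simp only [Finset.mem_filter, Finset.mem_Ico, Sym2.map_mk, Sym2.mk_isDiag_iff] at hh
        obtain ⟨k, hk, hne, i, hi⟩ := exists_leaf_ne_of_heapTree_ne (by omega) hh.1.2 hh.2
        obtain ⟨hkn, hM⟩ := hlf a b k hne
        -- Leaves are below `2 * N = 2 ^ (L + 1)`, so `L + 1` halvings give `0`, which is not a
        -- vertex.
        have hiL : i < L + 1 := by
          by_contra hcon
          have h2 : 2 ^ (L + 1) ≤ 2 ^ i := Nat.pow_le_pow_right (by norm_num) (by omega)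
          have h3 : (N + k) / 2 ^ i = 0 := Nat.div_eq_of_lt (by rw [pow_succ] at h2; omega)
          omega
        refine Finset.mem_image.2 ⟨(i, ⟨k, hkn⟩), ?_, hi⟩
        simp [hiL, hM]
      refine (Finset.card_le_card this).trans (Finset.card_image_le.trans ?_)
      rw [Finset.card_product, Finset.card_range]
      rfl
  calc (allTrees n N lf).card
      ≤ ∑ h ∈ Finset.Ico 1 (2 * N), (Finset.univ.image (f h)).card :=
        (Finset.card_le_card hsub).trans Finset.card_biUnion_le
    _ ≤ ∑ h ∈ Finset.Ico 1 (2 * N),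
          (1 + (T.edgeFinset.filter fun e => ¬ (e.map (f h)).IsDiag).card) :=
        Finset.sum_le_sum fun h _ => by
          convert card_image_le_of_connected hT.connected (f h)
    -- Double counting of the pairs of a heap vertex and a tree edge along which its subtree
    -- changes.
    _ = (2 * N - 1) + ∑ e ∈ T.edgeFinset,
          ((Finset.Ico 1 (2 * N)).filter fun h => ¬ (e.map (f h)).IsDiag).card := by
        rw [Finset.sum_add_distrib]
        simp only [Finset.card_filter]
        rw [Finset.sum_comm]
        simp
    _ ≤ 2 * N + ∑ e ∈ T.edgeFinset, (L + 1) * rowDist M e :=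
        Nat.add_le_add (Nat.sub_le _ _) (Finset.sum_le_sum fun e _ => hedge e)
    _ = 2 * N + (L + 1) * MWT M := by
        rw [← Finset.mul_sum, ← hW]
        unfold edgeWeight
        congr!

/-! ### Names for trees -/

/-- The state of the dictionary of trees after `cnt - n` insertions. The names `0, …, n` stand for
leaves, the names `n + 1, …, cnt` for inner nodes; `lt` and `rt` hold the names of the children, and
`tab` holds in cell `x * K + y` the name of the node with the children `x` and `y`, if there is one,
and otherwise `0`. The tree with the name `m` is `tr m`. -/
structure NameTable (n K cnt : ℕ) (U : Finset BTree) (tab lt rt off : ℕ → ℕ) (tr : ℕ → BTree) :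
    Prop where
  le : n ≤ cnt
  leaf : ∀ k ≤ n, tr k = .leaf k
  lt_lt : ∀ m, n < m → m ≤ cnt → lt m < m
  rt_lt : ∀ m, n < m → m ≤ cnt → rt m < m
  tab_eq : ∀ m, n < m → m ≤ cnt → tab (lt m * K + rt m) = m
  node : ∀ m, n < m → m ≤ cnt → tr m = .node (tr (lt m)) (tr (rt m))
  hit : ∀ c, tab c ≠ 0 → n < tab c ∧ tab c ≤ cnt ∧ c = lt (tab c) * K + rt (tab c)
  off_eq : ∀ m ≤ cnt, off m = m * K
  inj : ∀ m ≤ cnt, ∀ m' ≤ cnt, tr m = tr m' → m = m'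
  mem : ∀ m, n < m → m ≤ cnt → tr m ∈ U

theorem NameTable.empty {n K : ℕ} {U : Finset BTree} {lt rt off : ℕ → ℕ}
    (hoff : ∀ m ≤ n, off m = m * K) :
    NameTable n K n U (fun _ => 0) lt rt off .leaf where
  le := le_rfl
  leaf _ _ := rfl
  lt_lt m h h' := absurd h' (by omega)
  rt_lt m h h' := absurd h' (by omega)
  tab_eq m h h' := absurd h' (by omega)
  node m h h' := absurd h' (by omega)
  hit c h := absurd rfl h
  off_eq := hoff
  inj m _ m' _ h := BTree.leaf.inj h
  mem m h h' := absurd h' (by omega)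

variable {n K cnt : ℕ} {U : Finset BTree} {tab lt rt off : ℕ → ℕ} {tr : ℕ → BTree}

/-- Inner names inject into `U` through `tr`, so the bound on distinct trees becomes a bound on the
running time. -/
theorem NameTable.cnt_le (h : NameTable n K cnt U tab lt rt off tr) : cnt ≤ n + U.card := by
  classical
  have : (Finset.Ioc n cnt).card ≤ U.card :=
    Finset.card_le_card_of_injOn tr
      (fun m hm => by
        have := Finset.mem_Ioc.1 hm
        exact h.mem m this.1 this.2)
      (fun m hm m' hm' e => by
        have := Finset.mem_Ioc.1 hm
        have := Finset.mem_Ioc.1 hm'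
        exact h.inj m (by omega) m' (by omega) e)
  rw [Nat.card_Ioc] at this
  omega

theorem mul_add_inj {K x y x' y' : ℕ} (hy : y < K) (hy' : y' < K)
    (h : x * K + y = x' * K + y') : x = x' ∧ y = y' := by
  have hK : 0 < K := by omega
  have h1 := congrArg (· / K) h
  have h2 := congrArg (· % K) h
  simp only [Nat.mul_comm _ K, Nat.mul_add_div hK, Nat.mul_add_mod, Nat.div_eq_of_lt hy,
    Nat.div_eq_of_lt hy', Nat.mod_eq_of_lt hy, Nat.mod_eq_of_lt hy'] at h1 h2
  omega

theorem NameTable.lookup (h : NameTable n K cnt U tab lt rt off tr) (hK : cnt < K) {x y : ℕ}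
    (hy : y ≤ cnt) (hne : tab (x * K + y) ≠ 0) :
    tab (x * K + y) ≤ cnt ∧ tr (tab (x * K + y)) = .node (tr x) (tr y) := by
  obtain ⟨h1, h2, h3⟩ := h.hit _ hne
  have := h.rt_lt _ h1 h2
  obtain ⟨hx, hy⟩ := mul_add_inj (by omega) (by omega) h3
  refine ⟨h2, ?_⟩
  rw [h.node _ h1 h2, ← hx, ← hy]

/-- An empty cell certifies that the tree is new: by injectivity, an old name of it would have
exactly the children `x` and `y`, and its entry would fill that cell. Injectivity thus survives the
insertion. -/
theorem NameTable.insert (h : NameTable n K cnt U tab lt rt off tr) {x y : ℕ}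
    (hx : x ≤ cnt) (hy : y ≤ cnt) (h0 : tab (x * K + y) = 0)
    (hU : .node (tr x) (tr y) ∈ U) :
    NameTable n K (cnt + 1) U (Function.update tab (x * K + y) (cnt + 1))
      (Function.update lt (cnt + 1) x) (Function.update rt (cnt + 1) y)
      (Function.update off (cnt + 1) (off cnt + K))
      (Function.update tr (cnt + 1) (.node (tr x) (tr y))) := by
  have hle := h.le
  have hnew : ∀ m ≤ cnt, tr m ≠ .node (tr x) (tr y) := by
    intro m hm e
    by_cases hmn : m ≤ n
    · rw [h.leaf m hmn] at e; cases e
    · have hl := h.lt_lt m (by omega) hm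
      have hr := h.rt_lt m (by omega) hm
      rw [h.node m (by omega) hm] at e
      injection e with e1 e2
      have e1 := h.inj _ (by omega) _ hx e1
      have e2 := h.inj _ (by omega) _ hy e2
      have := h.tab_eq m (by omega) hm
      rw [e1, e2, h0] at this
      omega
  have hcases : ∀ m ≤ cnt + 1, m = cnt + 1 ∨ (m ≤ cnt ∧ m ≠ cnt + 1) := by omega
  constructor
  · omega
  · intro k hk
    rw [Function.update_of_ne (by omega), h.leaf k hk]
  · intro m hm hm'
    rcases hcases m hm' with rfl | ⟨h1, h2⟩
    · simp; omega
    · rw [Function.update_of_ne h2]; exact h.lt_lt m hm h1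
  · intro m hm hm'
    rcases hcases m hm' with rfl | ⟨h1, h2⟩
    · simp; omega
    · rw [Function.update_of_ne h2]; exact h.rt_lt m hm h1
  · intro m hm hm'
    rcases hcases m hm' with rfl | ⟨h1, h2⟩
    · simp
    · have h3 := h.tab_eq m hm h1
      rw [Function.update_of_ne h2, Function.update_of_ne h2, Function.update_of_ne, h3]
      intro e
      rw [e, h0] at h3
      omega
  · intro m hm hm'
    rcases hcases m hm' with rfl | ⟨h1, h2⟩
    · simp [Function.update_of_ne (show x ≠ cnt + 1 by omega),
        Function.update_of_ne (show y ≠ cnt + 1 by omega)]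
    · have hl := h.lt_lt m hm h1
      have hr := h.rt_lt m hm h1
      rw [Function.update_of_ne h2, Function.update_of_ne h2, Function.update_of_ne h2,
        Function.update_of_ne (by omega), Function.update_of_ne (by omega), h.node m hm h1]
  · intro c hc
    by_cases hcc : c = x * K + y
    · subst hcc; simp; omega
    · rw [Function.update_of_ne hcc] at hc ⊢
      obtain ⟨h1, h2, h3⟩ := h.hit c hc
      rw [Function.update_of_ne (by omega), Function.update_of_ne (by omega)]
      exact ⟨h1, by omega, h3⟩
  · intro m hm
    rcases hcases m hm with rfl | ⟨h1, h2⟩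
    · simp [h.off_eq cnt le_rfl, add_mul]
    · rw [Function.update_of_ne h2, h.off_eq m h1]
  · intro m hm m' hm' e
    rcases hcases m hm with rfl | ⟨h1, h2⟩ <;> rcases hcases m' hm' with rfl | ⟨h1', h2'⟩
    · rfl
    · rw [Function.update_self, Function.update_of_ne h2'] at e
      exact absurd e.symm (hnew _ h1')
    · rw [Function.update_self, Function.update_of_ne h2] at e
      exact absurd e (hnew _ h1)
    · rw [Function.update_of_ne h2, Function.update_of_ne h2'] at e
      exact h.inj m h1 m' h1' e
  · intro m hm hm'
    rcases hcases m hm' with rfl | ⟨h1, h2⟩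
    · simpa using hU
    · rw [Function.update_of_ne h2]; exact h.mem m hm h1


/-! ### The program

Variables: `0` holds `n`, `1` the number `N` of leaves, `7` the base `K` of the addresses in the
dictionary, `6` the number of names, `2` and `4` the outer loop index `i` and `i * n`, `3` and `5`
the inner loop index and its multiple. Integer arrays: `2` is the heap of the current column, `3`,
`4`, `5`, `6` form the dictionary, `7` holds the names of the columns and `8` the witness for each
name; the real array `2` holds the minimum for each name. If `tr` is true, all matrices are
transposed. -/

/-- The cell of an entry of a matrix that is transposed if `tr` is true. -/
def addr (n : ℕ) (tr : Bool) (i j : ℕ) : ℕ := if tr then j * n + i else i * n + j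

/-- The cell given by the outer and the inner loop index. -/
def cell (tr : Bool) : Expr := if tr then .add (.var 5) (.var 2) else .add (.var 4) (.var 3)

/-- Compute `N`, the least power of two that is at least `n`, and `K = 8 * N ^ 2`. -/
def computeSizes : Prog :=
  .seq (.assign 1 (.const 1)) <| .seq (.assign 7 (.const 8)) <|
    .while (.le (.add (.var 1) (.const 1)) (.var 0)) <|
      .seq (.assign 1 (.add (.var 1) (.var 1))) <|
        .assign 7 (.add (.add (.var 7) (.var 7)) (.add (.var 7) (.var 7)))

/-- Store `m * K` in cell `m` of array `6` for the names `m ≤ n` of leaves. -/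
def computeOffsets : Prog :=
  forLoop 3 5 (.write 6 (.add (.var 3) (.const 1)) (.add (.read 6 (.var 3)) (.var 7)))

/-- Load the leaves of the heap of a column. -/
def loadColumn (tr : Bool) : Prog :=
  forLoop 3 5 <| .ite (.le (.const 1) (.read 0 (cell (!tr))))
    (.write 2 (.add (.var 1) (.var 3)) (.add (.var 3) (.const 1)))
    (.write 2 (.add (.var 1) (.var 3)) (.const 0))

/-- Find the name of the next vertex of the heap, or create a new name. -/
def combine : Prog :=
  .seq (.assign 11 (.sub (.var 11) (.const 1))) <|
  .seq (.assign 8 (.read 2 (.add (.var 11) (.var 11)))) <|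
  .seq (.assign 9 (.read 2 (.add (.add (.var 11) (.var 11)) (.const 1)))) <|
  .seq (.assign 10 (.add (.read 6 (.var 8)) (.var 9))) <|
  .seq (.ite (.le (.read 3 (.var 10)) (.const 0))
    (.seq (.write 6 (.add (.var 6) (.const 1)) (.add (.read 6 (.var 6)) (.var 7))) <|
     .seq (.assign 6 (.add (.var 6) (.const 1))) <|
     .seq (.write 3 (.var 10) (.var 6)) <|
     .seq (.write 4 (.var 6) (.var 8)) <|
     .write 5 (.var 6) (.var 9))
    .skip) <|
  .write 2 (.var 11) (.read 3 (.var 10))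

/-- Find the name of a column. -/
def nameColumn (tr : Bool) : Prog :=
  .seq (loadColumn tr) <| .seq (.assign 11 (.var 1)) <|
    .seq (.while (.le (.const 2) (.var 11)) combine) <|
      .write 7 (.var 2) (.read 2 (.const 1))

/-- Find the names of all columns. -/
def nameColumns (tr : Bool) : Prog :=
  .seq (.assign 6 (.var 0)) (forLoop 2 4 (nameColumn tr))

/-- Load the minima and witnesses of the leaves for a row. -/
def loadRow (tr : Bool) : Prog :=
  forLoop 3 5 <| .seq (.rcopy 2 (.add (.var 3) (.const 1)) 0 (cell tr)) <|
    .write 8 (.add (.var 3) (.const 1)) (.var 3)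

/-- Compute the minimum and a witness for the next name. -/
def minStep : Prog :=
  .seq (.assign 11 (.add (.var 11) (.const 1))) <|
  .ite (.rle 2 (.read 4 (.var 11)) 2 (.read 5 (.var 11)))
    (.seq (.rcopy 2 (.var 11) 2 (.read 4 (.var 11))) <|
      .write 8 (.var 11) (.read 8 (.read 4 (.var 11))))
    (.seq (.rcopy 2 (.var 11) 2 (.read 5 (.var 11))) <|
      .write 8 (.var 11) (.read 8 (.read 5 (.var 11))))

/-- Output a row of the product. -/
def storeRow (tr : Bool) : Prog :=
  forLoop 3 5 <| .seq (.rcopy 1 (cell tr) 2 (.read 7 (.var 3))) <|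
    .write 1 (cell tr) (.read 8 (.read 7 (.var 3)))

/-- Compute a row of the product. -/
def productRow (tr : Bool) : Prog :=
  .seq (loadRow tr) <| .seq (.assign 11 (.var 0)) <|
    .seq (.while (.le (.add (.var 11) (.const 1)) (.var 6)) minStep) (storeRow tr)

/-- The program for the right mixed product (`tr = false`) and the left one (`tr = true`). -/
def mixedProg (tr : Bool) : Prog :=
  .seq computeSizes <| .seq computeOffsets <| .seq (nameColumns tr) (forLoop 2 4 (productRow tr))

/-! ### Naming the columns -/

theorem addr_inj {n : ℕ} {tr : Bool} {i j i' j' : ℕ} (hi : i < n) (hj : j < n) (hi' : i' < n)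
    (hj' : j' < n) (h : addr n tr i j = addr n tr i' j') : i = i' ∧ j = j' := by
  cases tr
  · exact mul_add_inj hj hj' h
  · exact (mul_add_inj hi hi' h).symm

/-- Relations between the sizes of the numbers that occur. -/
structure Sizes (n N K V : ℕ) : Prop where
  n_pos : 0 < n
  n_le : n ≤ N
  N_le : 8 * N ≤ K
  sq_le : n * n ≤ K
  names_lt : n + n * (2 * N) + 1 < K
  K_le : 8 * K ≤ V
  K_sq_le : K * K ≤ V

theorem Sizes.key_le {n N K V x y : ℕ} (h : Sizes n N K V) (hx : x < K) (hy : y < K) :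
    x * K + y ≤ V := by
  have : x * K + K ≤ K * K := by
    calc x * K + K = (x + 1) * K := by ring
      _ ≤ _ := Nat.mul_le_mul_right _ hx
  have := h.K_sq_le
  omega

theorem cell_eval {n i k : ℕ} (tr : Bool) {s : State} (h2 : s.var 2 = i) (h4 : s.var 4 = i * n)
    (h3 : s.var 3 = k) (h5 : s.var 5 = k * n) : (cell tr).eval s = addr n tr i k := by
  cases tr <;> simp [cell, addr, Expr.eval, *]

theorem cell_bounded {n N K V i k : ℕ} (hV : Sizes n N K V) (tr : Bool) {s : State} (hi : i < n)
    (hk : k < n) (h2 : s.var 2 = i) (h4 : s.var 4 = i * n) (h3 : s.var 3 = k)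
    (h5 : s.var 5 = k * n) : (cell tr).Bounded V s := by
  have := Nat.mul_le_mul_right n hi.le
  have := Nat.mul_le_mul_right n hk.le
  have := hV.sq_le
  have := hV.K_le
  have := hV.n_le
  have := hV.N_le
  cases tr <;> simp only [cell, Expr.Bounded, Expr.eval, if_true, Bool.false_eq_true, if_false, *]
    <;> omega

/-- The labels of the leaves of the heaps of the columns of the 0-1 matrix in `m0`. -/
def leafLabel (n : ℕ) (tr : Bool) (m0 : ℕ → ℕ) (j k : ℕ) : ℕ :=
  if k < n ∧ 1 ≤ m0 (addr n (!tr) j k) then k + 1 else 0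

theorem leafLabel_le {n : ℕ} {tr : Bool} {m0 : ℕ → ℕ} {j k : ℕ} : leafLabel n tr m0 j k ≤ n := by
  unfold leafLabel; split_ifs <;> omega

/-- The names of the first `j` columns have been found. -/
structure BuildInv (n N K : ℕ) (lf : ℕ → ℕ → ℕ) (m0 : ℕ → ℕ) (r0 : ℕ → ℕ → WithTop ℝ)
    (t : ℕ → BTree) (j : ℕ) (s : State) : Prop where
  hN : s.var 1 = N
  hK : s.var 7 = K
  hB : s.mem 0 = m0
  hA : s.rmem = r0
  hw : s.mem 8 = fun _ => 0
  pad : ∀ g, N + n ≤ g → s.mem 2 g = 0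
  names : NameTable n K (s.var 6) (allTrees n N lf) (s.mem 3) (s.mem 4) (s.mem 5) (s.mem 6) t
  roots : ∀ i < j, s.mem 7 i ≤ s.var 6 ∧ t (s.mem 7 i) = heapTree N (lf i) 1

section

variable {ω : ℕ → Bool} {n N K V : ℕ} {tr : Bool} {lf : ℕ → ℕ → ℕ} {m0 : ℕ → ℕ}
  {r0 : ℕ → ℕ → WithTop ℝ} {t : ℕ → BTree} {j : ℕ} {s : State}

theorem BuildInv.setVar (h : BuildInv n N K lf m0 r0 t j s) {x : ℕ} (v : ℕ) (h1 : x ≠ 1)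
    (h7 : x ≠ 7) (h6 : x ≠ 6) : BuildInv n N K lf m0 r0 t j (s.setVar x v) := by
  obtain ⟨hN, hK, hB, hA, hw, hp, hn, hr⟩ := h
  constructor <;> simpa [h1.symm, h7.symm, h6.symm]

theorem BuildInv.setHeap (h : BuildInv n N K lf m0 r0 t j s) {i : ℕ} (v : ℕ) (hi : i < N + n) :
    BuildInv n N K lf m0 r0 t j (s.setMem 2 i v) := by
  obtain ⟨hN, hK, hB, hA, hw, hp, hn, hr⟩ := h
  constructor <;> try simpa
  intro g hg
  simp [Function.update_of_ne (show g ≠ i by omega), hp g hg]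

theorem BuildInv.cnt_lt (h : BuildInv n N K lf m0 r0 t j s) (hV : Sizes n N K V) :
    s.var 6 + 1 < K := by
  have := h.names.cnt_le
  have := card_allTrees_le_mul n N lf
  have := hV.names_lt
  omega

theorem runs_loadColumn (hV : Sizes n N K V) (hm0 : ∀ c, m0 c ≤ 1)
    (hj : j < n) (h0 : s.var 0 = n) (h2 : s.var 2 = j) (h4 : s.var 4 = j * n)
    (hs : BuildInv n N K (leafLabel n tr m0) m0 r0 t j s) :
    Runs ω V (loadColumn tr) s (n * 40 + 10) fun s' => s'.var 0 = n ∧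
      s'.var 2 = j ∧ s'.var 4 = j * n ∧ BuildInv n N K (leafLabel n tr m0) m0 r0 t j s' ∧
        ∀ k < n, s'.mem 2 (N + k) = leafLabel n tr m0 j k := by
  have b1 := hV.sq_le
  have b2 := hV.K_le
  have b3 := hV.n_le
  have b4 := hV.N_le
  have b5 := hV.n_pos
  refine Runs.mono (Runs.forLoop (D := 22) (J := fun k s' => s'.var 2 = j ∧ s'.var 4 = j * n ∧
    BuildInv n N K (leafLabel n tr m0) m0 r0 t j s' ∧
      ∀ i < k, s'.mem 2 (N + i) = leafLabel n tr m0 j i)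
    (by norm_num) (by norm_num) (by norm_num) (by omega) (by omega) ?_ ?_ ?_ h0
    ⟨h2, h4, hs, by omega⟩) (by omega) fun _ h => h
  · rintro i s v ⟨h2, h4, hs, h⟩
    exact ⟨by simpa, by simpa, hs.setVar v (by norm_num) (by norm_num) (by norm_num), by simpa⟩
  · rintro i s v ⟨h2, h4, hs, h⟩
    exact ⟨by simpa, by simpa, hs.setVar v (by norm_num) (by norm_num) (by norm_num), by simpa⟩
  · rintro k hk s h0 h3 h5 ⟨h2, h4, hs, h⟩
    have hc := cell_eval (!tr) h2 h4 h3 h5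
    have hb := cell_bounded hV (!tr) hj hk h2 h4 h3 h5
    have hm := hm0 (addr n (!tr) j k)
    refine Runs.mono (Runs.of_wp ?_) ?_ fun _ h => h
    · simp only [Prog.wp, Test.Bounded, Test.holds, Expr.Bounded, Expr.eval, hb, hc, hs.hN, h3,
        hs.hB, true_and]
      have hpost : ∀ v, v = leafLabel n tr m0 j k → ∀ i < k + 1,
          (s.setMem 2 (N + k) v).mem 2 (N + i) = leafLabel n tr m0 j i := by
        intro v hv i hi
        rcases Nat.lt_succ_iff_lt_or_eq.1 hi with h' | rfl
        · simp [Function.update_of_ne (show N + i ≠ N + k by omega), h i h']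
        · simp [hv]
      refine ⟨by omega, fun h1 => ⟨by omega, by omega, ?_⟩, fun h1 => ⟨by omega, by omega, ?_⟩⟩
      · exact ⟨by simpa, by simpa, by simpa, by simpa, by simpa, hs.setHeap _ (by omega),
          hpost _ (by simp [leafLabel, hk, h1])⟩
      · exact ⟨by simpa, by simpa, by simpa, by simpa, by simpa, hs.setHeap _ (by omega),
          hpost _ (by simp [leafLabel, hk, h1])⟩
    · cases tr <;> simp [Prog.nodes, Test.nodes, Expr.nodes, cell]

/-- The heap of column `j` is known from vertex `h` on. -/
def HeapInv (n N K : ℕ) (lf : ℕ → ℕ → ℕ) (m0 : ℕ → ℕ) (r0 : ℕ → ℕ → WithTop ℝ) (j h : ℕ)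
    (s : State) : Prop :=
  s.var 0 = n ∧ s.var 2 = j ∧ s.var 4 = j * n ∧ s.var 11 = h ∧
    ∃ t, BuildInv n N K lf m0 r0 t j s ∧ ∀ g, h ≤ g → g < 2 * N →
      s.mem 2 g ≤ s.var 6 ∧ t (s.mem 2 g) = heapTree N (lf j) g

/-- The children `2 * h` and `2 * h + 1` already have names because the heap is processed downwards
in `h`. Either their pair is in the table, or a fresh name is inserted and `t` is extended by it. -/
theorem runs_combine (hV : Sizes n N K V) (hj : j < n) {h : ℕ} (h1 : 1 ≤ h) (hh : h < N)
    (hs : HeapInv n N K lf m0 r0 j (h + 1) s) :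
    Runs ω V combine s 60 (HeapInv n N K lf m0 r0 j h) := by
  obtain ⟨h0, h2, h4, h11, t, hb, hheap⟩ := hs
  have b2 := hV.K_le
  have b3 := hV.n_le
  have b4 := hV.N_le
  obtain ⟨hxle, hxt⟩ := hheap (h + h) (by omega) (by omega)
  obtain ⟨hyle, hyt⟩ := hheap (h + h + 1) (by omega) (by omega)
  have hcnt := hb.cnt_lt hV
  have hoff := hb.names.off_eq _ hxle
  have hoffc := hb.names.off_eq _ le_rfl
  have hnode : BTree.node (t (s.mem 2 (h + h))) (t (s.mem 2 (h + h + 1))) =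
      heapTree N (lf j) h := by
    rw [hxt, hyt, heapTree_of_lt _ (by omega) hh, two_mul]
  have hU : BTree.node (t (s.mem 2 (h + h))) (t (s.mem 2 (h + h + 1))) ∈ allTrees n N lf :=
    hnode ▸ heapTree_mem_allTrees hj (by omega) (by omega)
  have hkey := hV.key_le (x := s.mem 2 (h + h)) (y := s.mem 2 (h + h + 1)) (by omega) (by omega)
  have hkey' := hV.key_le (x := s.var 6 + 1) (y := 0) (by omega) (by omega)
  refine Runs.mono (Runs.of_wp ?_) (by simp [combine, Prog.nodes, Test.nodes, Expr.nodes])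
    fun _ h => h
  generalize hx : s.mem 2 (h + h) = x at *
  generalize hy : s.mem 2 (h + h + 1) = y at *
  simp [combine, Prog.wp, Test.Bounded, Test.holds, Expr.Bounded, Expr.eval, h11,
    hx, hy, hoff, hb.hK]
  -- A table cell contains `0` or a name in use.
  have htab : s.mem 3 (x * K + y) ≤ V := by
    by_cases e : s.mem 3 (x * K + y) = 0
    · omega
    · have := (hb.names.lookup (by omega) hyle e).1
      omega
  have hkey'' : s.var 6 * K + K ≤ V := by rw [← Nat.succ_mul]; omega
  refine ⟨by omega, by omega, by omega, by omega, by omega,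
    fun e => ⟨by omega, by omega, by omega, by omega, by omega, by omega, by omega, by omega,
      by omega, by omega, ?_⟩, fun e => ⟨by omega, by omega, ?_⟩⟩
  · refine ⟨by simpa, by simpa, by simpa, by simp,
      Function.update t (s.var 6 + 1) (.node (t x) (t y)), ?_, ?_⟩
    · have hins := hb.names.insert hxle hyle e hU
      obtain ⟨hN, hK, hB, hA, hw, hp, hn, hr⟩ := hb
      constructor
      · simpa
      · simpa
      · simpa
      · simpa
      · simpa
      · intro g hg
        simp [Function.update_of_ne (show g ≠ h by omega), hp g hg]
      · simpa using hins
      · intro i hi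
        have := hr i hi
        -- Roots found earlier have old names, so extending `t` at the fresh name leaves their trees
        -- unchanged.
        have e7 : s.mem 7 i ≠ s.var 6 + 1 := by omega
        refine ⟨by simp; omega, ?_⟩
        rw [Function.update_of_ne (by simpa using e7)]
        simpa using this.2
    · intro g hg hgN
      by_cases hgh : g = h
      · subst hgh
        simp [hnode]
      · have := hheap g (by omega) hgN
        simp [Function.update_of_ne hgh,
          Function.update_of_ne (show s.mem 2 g ≠ s.var 6 + 1 by omega), this]
        omega
  · obtain ⟨hle, ht⟩ := hb.names.lookup (by omega) hyle e
    refine ⟨by simpa, by simpa, by simpa, by simp, t, ?_, ?_⟩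
    · refine BuildInv.setHeap (BuildInv.setVar (BuildInv.setVar (BuildInv.setVar
        (BuildInv.setVar hb _ ?_ ?_ ?_) _ ?_ ?_ ?_) _ ?_ ?_ ?_) _ ?_ ?_ ?_) _ (by omega) <;> norm_num
    · intro g hg hgN
      by_cases hgh : g = h
      · subst hgh
        simp [hle, ht, hnode]
      · have := hheap g (by omega) hgN
        simp [Function.update_of_ne hgh, this]

theorem runs_nameColumn (hV : Sizes n N K V) (hm0 : ∀ c, m0 c ≤ 1)
    (hj : j < n) (h0 : s.var 0 = n) (h2 : s.var 2 = j) (h4 : s.var 4 = j * n)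
    (hs : BuildInv n N K (leafLabel n tr m0) m0 r0 t j s) :
    Runs ω V (nameColumn tr) s (n * 40 + N * 70 + 30) fun s' => s'.var 0 = n ∧ s'.var 2 = j ∧
      s'.var 4 = j * n ∧ ∃ t, BuildInv n N K (leafLabel n tr m0) m0 r0 t (j + 1) s' := by
  have b2 := hV.K_le
  have b3 := hV.n_le
  have b4 := hV.N_le
  have b5 := hV.n_pos
  have hloop := Runs.loop (ω := ω) (V := V) (m := N - 1) (D := 60)
    (b := .le (.const 2) (.var 11)) (p := combine)
    (I := fun q => HeapInv n N K (leafLabel n tr m0) m0 r0 j (N - q))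
    (by
      intro q hq s hs
      refine ⟨?_, ?_, ?_⟩
      · simp only [Test.Bounded, Expr.Bounded, hs.2.2.2.1]; omega
      · simp only [Test.holds, Expr.eval, hs.2.2.2.1]; omega
      · refine runs_combine hV hj (by omega) (by omega) ?_
        rwa [show N - (q + 1) + 1 = N - q by omega])
    (by
      intro s hs
      refine ⟨?_, ?_⟩
      · simp only [Test.Bounded, Expr.Bounded, hs.2.2.2.1]; omega
      · simp only [Test.holds, Expr.eval, hs.2.2.2.1]; omega)
  refine Runs.mono (Runs.seq (runs_loadColumn hV hm0 hj h0 h2 h4 hs) fun s hs =>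
    Runs.seq (T₁ := 2) (Runs.of_wp ?_) fun s hs => Runs.seq (hloop s hs) fun s hs =>
      Runs.of_wp ?_) ?_ fun _ h => h
  · obtain ⟨h0, h2, h4, hb, hl⟩ := hs
    simp only [Prog.wp, Expr.Bounded, Expr.eval, hb.hN]
    refine ⟨by omega, by simpa, by simpa, by simpa, by simp, t,
      hb.setVar _ (by norm_num) (by norm_num) (by norm_num), ?_⟩
    intro g hg hgN
    have hle := hb.names.le
    -- Cells from `N + n` on are never written and hold `0`, the label of a padding leaf. A leaf's
    -- label also serves as its name.
    have hval : s.mem 2 g = leafLabel n tr m0 j (g - N) := by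
      by_cases hgn : g < N + n
      · rw [← hl (g - N) (by omega)]
        congr 1; omega
      · rw [hb.pad g (by omega)]
        simp only [leafLabel]
        rw [if_neg (by omega)]
    have hlab : leafLabel n tr m0 j (g - N) ≤ n := leafLabel_le
    rw [heapTree_of_le _ (by omega)]
    simp only [State.setVar_mem, State.setVar_var, hval]
    exact ⟨by simp; omega, hb.names.leaf _ hlab⟩
  · rw [show N - (N - 1) = 1 by omega] at hs
    obtain ⟨h0, h2, h4, -, t, hb, hl⟩ := hs
    have hcnt := hb.cnt_lt hV
    obtain ⟨hle, ht⟩ := hl 1 le_rfl (by omega)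
    simp only [Prog.wp, Expr.Bounded, Expr.eval, h2]
    refine ⟨by omega, by omega, by simpa, by simpa, by simpa, t, ?_⟩
    obtain ⟨hN, hK, hB, hA, hw, hp, hn, hr⟩ := hb
    constructor <;> try simpa
    intro i hi
    by_cases hij : i = j
    · subst hij
      simp [hle, ht]
    · simp [Function.update_of_ne hij, hr i (by omega)]
  · simp only [Test.nodes, Expr.nodes, Prog.nodes]
    omega

theorem runs_nameColumns (hV : Sizes n N K V) (hm0 : ∀ c, m0 c ≤ 1) (h0 : s.var 0 = n)
    (hN : s.var 1 = N) (hK : s.var 7 = K) (hB : s.mem 0 = m0) (hA : s.rmem = r0)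
    (hmem : ∀ a, a ≠ 0 → a ≠ 6 → s.mem a = fun _ => 0) (hoff : ∀ m ≤ n, s.mem 6 m = m * K) :
    Runs ω V (nameColumns tr) s (n * (n * 40 + N * 70 + 44) + 12) fun s' => s'.var 0 = n ∧
      ∃ t, BuildInv n N K (leafLabel n tr m0) m0 r0 t n s' := by
  have b1 := hV.sq_le
  have b2 := hV.K_le
  have b3 := hV.n_le
  have b4 := hV.N_le
  have b5 := hV.n_pos
  refine Runs.mono (Runs.seq (T₁ := 2) (R := fun s' => s'.var 0 = n ∧
      ∃ t, BuildInv n N K (leafLabel n tr m0) m0 r0 t 0 s') (Runs.of_wp ?_) fun s hs =>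
    Runs.forLoop (D := n * 40 + N * 70 + 30)
      (J := fun j s => ∃ t, BuildInv n N K (leafLabel n tr m0) m0 r0 t j s)
      (by norm_num) (by norm_num) (by norm_num) (by omega) (by omega) ?_ ?_ ?_ hs.1 hs.2)
    (le_of_eq (by ring)) fun _ h => h
  · simp only [Prog.wp, Expr.Bounded, Expr.eval, h0]
    refine ⟨by omega, by simpa, .leaf, ?_⟩
    constructor
    · simpa
    · simpa
    · simpa
    · simpa
    · simp [hmem 8]
    · simp [hmem 2]
    · simpa [hmem 3] using NameTable.empty hoff
    · simp
  · rintro j s v ⟨t, hs⟩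
    exact ⟨t, hs.setVar v (by norm_num) (by norm_num) (by norm_num)⟩
  · rintro j s v ⟨t, hs⟩
    exact ⟨t, hs.setVar v (by norm_num) (by norm_num) (by norm_num)⟩
  · rintro j hj s h0 h2 h4 ⟨t, hs⟩
    exact runs_nameColumn hV hm0 hj h0 h2 h4 hs

end


/-! ### Computing the product -/

/-- `v` is the minimum of `a` on `S`, and `w` is a place where it is attained, if it is finite. -/
def IsMinWit (S : Finset ℕ) (a : ℕ → WithTop ℝ) (v : WithTop ℝ) (w : ℕ) : Prop :=
  v = S.inf a ∧ (v ≠ ⊤ → w ∈ S ∧ a w = v)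

/-- An inner node inherits value and witness from the child with the smaller minimum; no
disjointness is needed. -/
theorem IsMinWit.union_left {S S' : Finset ℕ} {a : ℕ → WithTop ℝ} {v v' : WithTop ℝ} {w w' : ℕ}
    (h : IsMinWit S a v w) (h' : IsMinWit S' a v' w') (hle : v ≤ v') :
    IsMinWit (S ∪ S') a v w := by
  refine ⟨?_, fun hv => ⟨Finset.mem_union_left _ (h.2 hv).1, (h.2 hv).2⟩⟩
  rw [Finset.inf_union, ← h.1, ← h'.1, inf_eq_left.2 hle]

theorem IsMinWit.union_right {S S' : Finset ℕ} {a : ℕ → WithTop ℝ} {v v' : WithTop ℝ} {w w' : ℕ}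
    (h : IsMinWit S a v w) (h' : IsMinWit S' a v' w') (hle : v' ≤ v) :
    IsMinWit (S ∪ S') a v' w' := by
  rw [Finset.union_comm]
  exact h'.union_left h hle

/-- The data that do not change during the computation of the product. -/
structure RowInv (n cnt : ℕ) (lt rt root : ℕ → ℕ) (r0 : ℕ → WithTop ℝ) (s : State) : Prop where
  cnt_eq : s.var 6 = cnt
  lt_eq : s.mem 4 = lt
  rt_eq : s.mem 5 = rt
  root_eq : s.mem 7 = root
  hA : s.rmem 0 = r0
  top : s.rmem 2 0 = ⊤
  wit_le : ∀ m, s.mem 8 m ≤ n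

/-- The first `i` rows of the product have been computed. -/
def RowsDone (n : ℕ) (tr : Bool) (S : ℕ → Finset ℕ) (r0 : ℕ → WithTop ℝ) (i : ℕ) (s : State) :
    Prop :=
  ∀ i' < i, ∀ j < n, IsMinWit (S j) (fun k => r0 (addr n tr i' k)) (s.rmem 1 (addr n tr i' j))
    (s.mem 1 (addr n tr i' j))

section

variable {ω : ℕ → Bool} {n N K V cnt : ℕ} {tr : Bool} {U : Finset BTree}
  {tab lt rt off root : ℕ → ℕ} {r0 : ℕ → WithTop ℝ} {t : ℕ → BTree} {S : ℕ → Finset ℕ} {i : ℕ}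
  {s : State}

theorem RowInv.setVar (h : RowInv n cnt lt rt root r0 s) {x : ℕ} (v : ℕ) (h6 : x ≠ 6) :
    RowInv n cnt lt rt root r0 (s.setVar x v) := by
  obtain ⟨h1, h2, h3, h4, h5, h6, h7⟩ := h
  constructor <;> simpa [Ne.symm ‹x ≠ 6›]

theorem RowInv.setName (h : RowInv n cnt lt rt root r0 s) {m v : ℕ} {w : WithTop ℝ} (hm : m ≠ 0)
    (hv : v ≤ n) : RowInv n cnt lt rt root r0 ((s.setReal 2 m w).setMem 8 m v) := by
  obtain ⟨h1, h2, h3, h4, h5, h6, h7⟩ := h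
  constructor <;> try simpa
  · simpa [Function.update_of_ne hm.symm]
  · intro m'
    by_cases e : m' = m
    · subst e; simpa
    · simpa [Function.update_of_ne e] using h7 m'

theorem RowInv.setOut (h : RowInv n cnt lt rt root r0 s) {c v : ℕ} {w : WithTop ℝ} :
    RowInv n cnt lt rt root r0 ((s.setReal 1 c w).setMem 1 c v) := by
  obtain ⟨h1, h2, h3, h4, h5, h6, h7⟩ := h
  constructor <;> simpa

/-- In row `i`, minima and witnesses are known for the names up to `m`. -/
def NamesDone (n : ℕ) (tr : Bool) (t : ℕ → BTree) (r0 : ℕ → WithTop ℝ) (i m : ℕ) (s : State) :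
    Prop :=
  ∀ m' ≤ m, IsMinWit (t m').ones (fun k => r0 (addr n tr i k)) (s.rmem 2 m') (s.mem 8 m')

theorem NamesDone.setName (h : NamesDone n tr t r0 i m s) {v : ℕ} {w : WithTop ℝ}
    (hm : IsMinWit (t (m + 1)).ones (fun k => r0 (addr n tr i k)) w v) :
    NamesDone n tr t r0 i (m + 1) ((s.setReal 2 (m + 1) w).setMem 8 (m + 1) v) := by
  intro m' hm'
  by_cases e : m' = m + 1
  · subst e; simpa
  · simpa [Function.update_of_ne e] using h m' (by omega)

theorem runs_loadRow (hV : Sizes n N K V) (hi : i < n) (ht : ∀ k ≤ n, t k = .leaf k)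
    (h0 : s.var 0 = n) (h2 : s.var 2 = i) (h4 : s.var 4 = i * n)
    (hs : RowInv n cnt lt rt root r0 s) (hd : RowsDone n tr S r0 i s) :
    Runs ω V (loadRow tr) s (n * 26 + 10) fun s' => s'.var 0 = n ∧
      s'.var 2 = i ∧ s'.var 4 = i * n ∧ RowInv n cnt lt rt root r0 s' ∧ RowsDone n tr S r0 i s' ∧
        NamesDone n tr t r0 i n s' := by
  have b1 := hV.sq_le
  have b2 := hV.K_le
  have b3 := hV.n_le
  have b4 := hV.N_le
  have b5 := hV.n_pos
  refine Runs.mono (Runs.forLoop (D := 12) (J := fun k s' => s'.var 2 = i ∧ s'.var 4 = i * n ∧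
    RowInv n cnt lt rt root r0 s' ∧ RowsDone n tr S r0 i s' ∧ NamesDone n tr t r0 i k s')
    (by norm_num) (by norm_num) (by norm_num) (by omega) (by omega) ?_ ?_ ?_ h0
    ⟨h2, h4, hs, hd, ?_⟩) (by omega) fun _ h => h
  · rintro k s v ⟨h2, h4, hs, h, h'⟩
    exact ⟨by simpa, by simpa, hs.setVar v (by norm_num), by simpa [RowsDone],
      by simpa [NamesDone]⟩
  · rintro k s v ⟨h2, h4, hs, h, h'⟩
    exact ⟨by simpa, by simpa, hs.setVar v (by norm_num), by simpa [RowsDone],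
      by simpa [NamesDone]⟩
  · rintro k hk s h0 h3 h5 ⟨h2, h4, hs, h, h'⟩
    have hc := cell_eval tr h2 h4 h3 h5
    have hb := cell_bounded hV tr hi hk h2 h4 h3 h5
    refine Runs.mono (Runs.of_wp ?_) ?_ fun _ h => h
    · simp only [Prog.wp, Expr.Bounded, Expr.eval, State.setReal_var, hb, hc, h3, hs.hA, true_and]
      refine ⟨by omega, by omega, by omega, by simpa, by simpa, by simpa, by simpa, by simpa,
        hs.setName (by omega) hk.le, by simpa [RowsDone], h'.setName ?_⟩
      rw [ht (k + 1) hk]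
      simp [IsMinWit, BTree.ones]
    · cases tr <;> simp [Prog.nodes, Expr.nodes, cell]
  -- Name `0` is the empty leaf: its minimum is `⊤`, so no witness is required.
  · intro m hm
    obtain rfl : m = 0 := by omega
    simp [IsMinWit, ht, BTree.ones, hs.top]

/-- Children have smaller names than their parent, so in increasing order of names both minima are
already available. -/
theorem runs_minStep (hV : Sizes n N K V) (hnt : NameTable n K cnt U tab lt rt off t)
    (hcnt : cnt < K) {m : ℕ} (hm : n ≤ m) (hmc : m < cnt) (h0 : s.var 0 = n) (h2 : s.var 2 = i)
    (h4 : s.var 4 = i * n) (h11 : s.var 11 = m)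
    (hs : RowInv n cnt lt rt root r0 s) (hd : RowsDone n tr S r0 i s)
    (hm' : NamesDone n tr t r0 i m s) :
    Runs ω V minStep s 28 fun s' => s'.var 0 = n ∧ s'.var 2 = i ∧ s'.var 4 = i * n ∧
      s'.var 11 = m + 1 ∧ RowInv n cnt lt rt root r0 s' ∧ RowsDone n tr S r0 i s' ∧
        NamesDone n tr t r0 i (m + 1) s' := by
  have b2 := hV.K_le
  have b3 := hV.n_le
  have b4 := hV.N_le
  have hl := hnt.lt_lt (m + 1) (by omega) (by omega)
  have hr := hnt.rt_lt (m + 1) (by omega) (by omega)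
  have hnode := hnt.node (m + 1) (by omega) (by omega)
  have hminl := hm' (lt (m + 1)) (by omega)
  have hminr := hm' (rt (m + 1)) (by omega)
  have hwl := hs.wit_le (lt (m + 1))
  have hwr := hs.wit_le (rt (m + 1))
  have hs' := hs.setVar (x := 11) (m + 1) (by norm_num)
  have hm'' : NamesDone n tr t r0 i m (s.setVar 11 (m + 1)) := hm'
  refine Runs.mono (Runs.of_wp ?_) (by simp [minStep, Prog.nodes, Test.nodes, Expr.nodes])
    fun _ h => h
  simp only [minStep, Prog.wp, Test.Bounded, Test.holds, Expr.Bounded, Expr.eval,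
    State.setVar_var, State.setVar_mem, State.setVar_rmem, State.setReal_mem, State.setReal_var,
    h11, hs.lt_eq, hs.rt_eq, if_true]
  refine ⟨by omega, by omega, fun hle => ⟨by omega, by omega, by omega, by omega, ?_⟩,
    fun hle => ⟨by omega, by omega, by omega, by omega, ?_⟩⟩
  · refine ⟨by simpa, by simpa, by simpa, by simp, hs'.setName (by omega) hwl,
      by simpa [RowsDone], hm''.setName ?_⟩
    rw [hnode, BTree.ones]
    exact hminl.union_left hminr hle
  · refine ⟨by simpa, by simpa, by simpa, by simp, hs'.setName (by omega) hwr,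
      by simpa [RowsDone], hm''.setName ?_⟩
    rw [hnode, BTree.ones]
    exact hminl.union_right hminr (le_of_not_ge hle)

theorem runs_storeRow (hV : Sizes n N K V) (hi : i < n) (hcnt : cnt < K)
    (hroot : ∀ j < n, root j ≤ cnt ∧ (t (root j)).ones = S j)
    (h0 : s.var 0 = n) (h2 : s.var 2 = i) (h4 : s.var 4 = i * n)
    (hs : RowInv n cnt lt rt root r0 s) (hd : RowsDone n tr S r0 i s)
    (hm : NamesDone n tr t r0 i cnt s) :
    Runs ω V (storeRow tr) s (n * 27 + 10) fun s' => s'.var 0 = n ∧ s'.var 2 = i ∧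
      s'.var 4 = i * n ∧ RowInv n cnt lt rt root r0 s' ∧ RowsDone n tr S r0 (i + 1) s' := by
  have b1 := hV.sq_le
  have b2 := hV.K_le
  have b3 := hV.n_le
  have b4 := hV.N_le
  have b5 := hV.n_pos
  refine Runs.mono (Runs.forLoop (D := 13) (J := fun k s' => s'.var 2 = i ∧ s'.var 4 = i * n ∧
    RowInv n cnt lt rt root r0 s' ∧ NamesDone n tr t r0 i cnt s' ∧
      ∀ i' ≤ i, ∀ j < n, (i' = i → j < k) → IsMinWit (S j) (fun k => r0 (addr n tr i' k))
        (s'.rmem 1 (addr n tr i' j)) (s'.mem 1 (addr n tr i' j)))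
    (by norm_num) (by norm_num) (by norm_num) (by omega) (by omega) ?_ ?_ ?_ h0
    ⟨h2, h4, hs, hm, ?_⟩) (by omega) ?_
  · rintro k s v ⟨h2, h4, hs, h, h'⟩
    exact ⟨by simpa, by simpa, hs.setVar v (by norm_num), by simpa [NamesDone], by simpa⟩
  · rintro k s v ⟨h2, h4, hs, h, h'⟩
    exact ⟨by simpa, by simpa, hs.setVar v (by norm_num), by simpa [NamesDone], by simpa⟩
  · rintro k hk s h0 h3 h5 ⟨h2, h4, hs, h, h'⟩
    have hc := cell_eval tr h2 h4 h3 h5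
    have hb := cell_bounded hV tr hi hk h2 h4 h3 h5
    obtain ⟨hr, hS⟩ := hroot k hk
    have hw := hs.wit_le (root k)
    have hmin := h (root k) hr
    rw [hS] at hmin
    refine Runs.mono (Runs.of_wp ?_) ?_ fun _ h => h
    · have hc' : ∀ v w, (cell tr).eval (s.setReal v w (s.rmem 2 (root k))) = addr n tr i k :=
        fun v w => cell_eval tr (by simpa) (by simpa) (by simpa) (by simpa)
      have hb' : ∀ v w, (cell tr).Bounded V (s.setReal v w (s.rmem 2 (root k))) :=
        fun v w => cell_bounded hV tr hi hk (by simpa) (by simpa) (by simpa) (by simpa)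
      simp only [Prog.wp, Expr.Bounded, Expr.eval, State.setReal_var, State.setReal_mem, hb, hc,
        hc', hb', h3, hs.root_eq, true_and]
      refine ⟨by omega, by omega, by simpa, by simpa, by simpa, by simpa, by simpa, hs.setOut,
        by simpa [NamesDone], ?_⟩
      intro i' hi' j hj hij
      -- Addresses are injective, so the write affects only the entry `(i, k)`; all other entries
      -- keep their earlier guarantee.
      by_cases e : addr n tr i' j = addr n tr i k
      · obtain ⟨rfl, rfl⟩ := addr_inj (by omega) hj hi hk e
        simpa using hmin
      · simp only [State.setMem_rmem, State.setReal_rmem, State.setMem_mem, State.setReal_mem,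
          if_true, Function.update_of_ne e]
        refine h' i' hi' j hj fun h => ?_
        have := hij h
        have : j ≠ k := by rintro rfl; exact e (by rw [h])
        omega
    · cases tr <;> simp [Prog.nodes, Expr.nodes, cell]
  · intro i' hi' j hj h
    exact hd i' (by by_contra hc; exact absurd (h (by omega)) (by omega)) j hj
  · rintro s ⟨h0, h2, h4, hs, -, h⟩
    exact ⟨h0, h2, h4, hs, fun i' hi' j hj => h i' (by omega) j hj fun _ => hj⟩

theorem runs_productRow (hV : Sizes n N K V) (hi : i < n)
    (hnt : NameTable n K cnt U tab lt rt off t) (hcnt : cnt < K)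
    (hroot : ∀ j < n, root j ≤ cnt ∧ (t (root j)).ones = S j)
    (h0 : s.var 0 = n) (h2 : s.var 2 = i) (h4 : s.var 4 = i * n)
    (hs : RowInv n cnt lt rt root r0 s) (hd : RowsDone n tr S r0 i s) :
    Runs ω V (productRow tr) s (n * 60 + cnt * 34 + 40) fun s' => s'.var 0 = n ∧ s'.var 2 = i ∧
      s'.var 4 = i * n ∧ RowInv n cnt lt rt root r0 s' ∧ RowsDone n tr S r0 (i + 1) s' := by
  have b2 := hV.K_le
  have b3 := hV.n_le
  have b4 := hV.N_le
  have hle := hnt.le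
  have hloop := Runs.loop (ω := ω) (V := V) (m := cnt - n) (D := 28)
    (b := .le (.add (.var 11) (.const 1)) (.var 6)) (p := minStep)
    (I := fun q s => s.var 0 = n ∧ s.var 2 = i ∧ s.var 4 = i * n ∧ s.var 11 = n + q ∧
      RowInv n cnt lt rt root r0 s ∧ RowsDone n tr S r0 i s ∧ NamesDone n tr t r0 i (n + q) s)
    (by
      rintro q hq s ⟨h0, h2, h4, h11, hs, hd, hm⟩
      refine ⟨?_, ?_,
        runs_minStep (m := n + q) hV hnt hcnt (by omega) (by omega) h0 h2 h4 h11 hs hd hm⟩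
      · simp only [Test.Bounded, Expr.Bounded, Expr.eval, h11, hs.cnt_eq]; omega
      · simp only [Test.holds, Expr.eval, h11, hs.cnt_eq]; omega)
    (by
      rintro s ⟨h0, h2, h4, h11, hs, hd, hm⟩
      refine ⟨?_, ?_⟩
      · simp only [Test.Bounded, Expr.Bounded, Expr.eval, h11, hs.cnt_eq]; omega
      · simp only [Test.holds, Expr.eval, h11, hs.cnt_eq]; omega)
  refine Runs.mono (Runs.seq (runs_loadRow hV hi hnt.leaf h0 h2 h4 hs hd) fun s hs =>
    Runs.seq (T₁ := 2) (Runs.of_wp ?_) fun s hs => Runs.seq (hloop s hs) fun s hs => ?_)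
    (T := (n * 26 + 10) + (2 + (((cnt - n) * 34 + 6) + (n * 27 + 10)))) (by omega) fun _ h => h
  · obtain ⟨h0, h2, h4, hs, hd, hm⟩ := hs
    simp only [Prog.wp, Expr.Bounded, Expr.eval, h0]
    exact ⟨by omega, by simpa, by simpa, by simpa, by simp, hs.setVar _ (by norm_num),
      by simpa [RowsDone], by simpa [NamesDone]⟩
  · obtain ⟨h0, h2, h4, h11, hs, hd, hm⟩ := hs
    rw [show n + (cnt - n) = cnt by omega] at hm
    exact runs_storeRow hV hi hcnt hroot h0 h2 h4 hs hd hm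

theorem runs_productRows (hV : Sizes n N K V)
    (hnt : NameTable n K cnt U tab lt rt off t) (hcnt : cnt < K)
    (hroot : ∀ j < n, root j ≤ cnt ∧ (t (root j)).ones = S j)
    (h0 : s.var 0 = n) (hs : RowInv n cnt lt rt root r0 s) :
    Runs ω V (forLoop 2 4 (productRow tr)) s (n * (n * 60 + cnt * 34 + 54) + 10)
      (RowsDone n tr S r0 n) := by
  have b1 := hV.sq_le
  have b2 := hV.K_le
  have b3 := hV.n_le
  have b4 := hV.N_le
  have b5 := hV.n_pos
  refine Runs.mono (Runs.forLoop (D := n * 60 + cnt * 34 + 40)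
    (J := fun i s => RowInv n cnt lt rt root r0 s ∧ RowsDone n tr S r0 i s)
    (by norm_num) (by norm_num) (by norm_num) (by omega) (by omega) ?_ ?_ ?_ h0
    ⟨hs, fun i hi => absurd hi (by omega)⟩) le_rfl fun s hs => hs.2.2
  · rintro i s v ⟨hs, hd⟩
    exact ⟨hs.setVar v (by norm_num), by simpa [RowsDone]⟩
  · rintro i s v ⟨hs, hd⟩
    exact ⟨hs.setVar v (by norm_num), by simpa [RowsDone]⟩
  · rintro i hi s h0 h2 h4 ⟨hs, hd⟩
    exact runs_productRow hV hi hnt hcnt hroot h0 h2 h4 hs hd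

end


/-! ### The whole program -/

/-- Here `K = 8 * N ^ 2` exceeds every possible name, and `V = K ^ 2 = 2 ^ (4 * L + 6)` bounds every
table address. -/
theorem sizes_clog {n : ℕ} (hn : 1 ≤ n) :
    Sizes n (2 ^ Nat.clog 2 n) (8 * (2 ^ Nat.clog 2 n * 2 ^ Nat.clog 2 n))
      (2 ^ (4 * Nat.clog 2 n + 6)) := by
  have hle := Nat.le_pow_clog (b := 2) (by norm_num) n
  have hsq : 2 ^ (4 * Nat.clog 2 n + 6) = 8 * (2 ^ Nat.clog 2 n * 2 ^ Nat.clog 2 n) *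
      (8 * (2 ^ Nat.clog 2 n * 2 ^ Nat.clog 2 n)) := by ring
  rw [hsq]
  generalize 2 ^ Nat.clog 2 n = N at *
  constructor
  · exact hn
  · exact hle
  · nlinarith
  · nlinarith
  · nlinarith
  · exact Nat.mul_le_mul_right _ (by nlinarith)
  · exact le_rfl

theorem two_pow_clog_le {n : ℕ} (hn : 1 ≤ n) : 2 ^ Nat.clog 2 n ≤ 2 * n := by
  rcases hn.eq_or_lt with rfl | h
  · simp
  · have h1 := Nat.pow_pred_clog_lt_self (b := 2) (by norm_num) h
    have h2 := Nat.clog_pos (b := 2) (by norm_num) h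
    calc 2 ^ Nat.clog 2 n = 2 * 2 ^ (Nat.clog 2 n).pred := by
          rw [← pow_succ', ← Nat.succ_eq_add_one, Nat.succ_pred_eq_of_pos h2]
      _ ≤ _ := by omega

section

variable {ω : ℕ → Bool} {n N K V : ℕ} {tr : Bool} {s : State}

theorem runs_computeSizes (hn : 1 ≤ n) (h0 : s.var 0 = n) :
    Runs ω (2 ^ (4 * Nat.clog 2 n + 6)) computeSizes s (Nat.clog 2 n * 18 + 10) fun s' =>
      s'.var 0 = n ∧ s'.mem = s.mem ∧ s'.rmem = s.rmem ∧ s'.var 1 = 2 ^ Nat.clog 2 n ∧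
        s'.var 7 = 8 * (2 ^ Nat.clog 2 n * 2 ^ Nat.clog 2 n) := by
  have hV := sizes_clog hn
  have b2 := hV.K_le
  have b3 := hV.n_le
  have b4 := hV.N_le
  have hloop := Runs.loop (ω := ω) (V := 2 ^ (4 * Nat.clog 2 n + 6)) (m := Nat.clog 2 n) (D := 12)
    (b := .le (.add (.var 1) (.const 1)) (.var 0))
    (p := .seq (.assign 1 (.add (.var 1) (.var 1))) <|
        .assign 7 (.add (.add (.var 7) (.var 7)) (.add (.var 7) (.var 7))))
    (I := fun q s' => s'.var 0 = n ∧ s'.mem = s.mem ∧ s'.rmem = s.rmem ∧ s'.var 1 = 2 ^ q ∧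
        s'.var 7 = 8 * (2 ^ q * 2 ^ q))
    (by
      rintro q hq s' ⟨h0, hm, hr, h1, h7⟩
      have hlt := Nat.pow_lt_of_lt_clog hq
      have hle : 2 ^ q + 2 ^ q ≤ 2 ^ Nat.clog 2 n := by
        rw [← two_mul, ← pow_succ']
        exact Nat.pow_le_pow_right (by norm_num) hq
      have hK : 4 * (8 * (2 ^ q * 2 ^ q)) ≤ 8 * (2 ^ Nat.clog 2 n * 2 ^ Nat.clog 2 n) := by
        have := Nat.mul_le_mul hle hle
        linarith
      refine ⟨?_, ?_, Runs.of_wp ?_⟩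
      · simp only [Test.Bounded, Expr.Bounded, Expr.eval, h0, h1]; omega
      · simp only [Test.holds, Expr.eval, h0, h1]; omega
      · simp only [Prog.wp, Expr.Bounded, Expr.eval, State.setVar_var, h1, h7]
        norm_num only [if_true, if_false]
        refine ⟨by omega, ⟨by omega, by omega⟩, h0, hm, hr, by ring, by ring⟩)
    (by
      rintro s' ⟨h0, hm, hr, h1, h7⟩
      refine ⟨?_, ?_⟩
      · simp only [Test.Bounded, Expr.Bounded, Expr.eval, h0, h1]; omega
      · simp only [Test.holds, Expr.eval, h0, h1]; omega)
  refine Runs.mono (Runs.seq (T₁ := 2) (R := fun s' => s'.var 0 = n ∧ s'.mem = s.mem ∧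
      s'.rmem = s.rmem ∧ s'.var 1 = 1) (Runs.of_wp ?_) fun s' hs =>
    Runs.seq (T₁ := 2) (Runs.of_wp ?_) fun s hs => hloop s hs) ?_ fun _ h => h
  · simp only [Prog.wp, Expr.Bounded, Expr.eval]
    exact ⟨by omega, by simpa, by simp, by simp, by simp⟩
  · simp only [Prog.wp, Expr.Bounded, Expr.eval]
    exact ⟨by omega, by simpa using hs.1, by simp [hs.2.1], by simp [hs.2.2.1],
      by simp [hs.2.2.2], by simp⟩
  · simp only [Test.nodes, Expr.nodes]
    omega

theorem runs_computeOffsets (hV : Sizes n N K V) (h0 : s.var 0 = n) (h1 : s.var 1 = N)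
    (h7 : s.var 7 = K) (h6 : s.mem 6 0 = 0) :
    Runs ω V computeOffsets s (n * 22 + 10) fun s' => s'.var 0 = n ∧ s'.var 1 = N ∧
      s'.var 7 = K ∧ s'.rmem = s.rmem ∧ (∀ a, a ≠ 6 → s'.mem a = s.mem a) ∧
        ∀ m ≤ n, s'.mem 6 m = m * K := by
  have b1 := hV.sq_le
  have b2 := hV.K_le
  have b3 := hV.n_le
  have b4 := hV.N_le
  have b5 := hV.n_pos
  refine Runs.mono (Runs.forLoop (D := 8) (J := fun k s' => s'.var 1 = N ∧
      s'.var 7 = K ∧ s'.rmem = s.rmem ∧ (∀ a, a ≠ 6 → s'.mem a = s.mem a) ∧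
        ∀ m ≤ k, s'.mem 6 m = m * K)
    (by norm_num) (by norm_num) (by norm_num) (by omega) (by omega) ?_ ?_ ?_ h0
    ⟨h1, h7, rfl, fun _ _ => rfl, fun m hm => ?_⟩) le_rfl fun _ h => h
  · rintro k s' v h
    simpa using h
  · rintro k s' v h
    simpa using h
  · rintro k hk s' h0 h3 h5 ⟨h1, h7, hr, hm, h6⟩
    refine Runs.of_wp ?_
    have := hV.key_le (x := k) (y := 0) (by omega) (by omega)
    have := hV.key_le (x := k + 1) (y := 0) (by omega) (by omega)
    have : (k + 1) * K = k * K + K := by ring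
    simp only [Prog.wp, Expr.Bounded, Expr.eval, h3, h6 k le_rfl, h7]
    refine ⟨by omega, by omega, by simpa, by simpa, by simpa, by simpa, by simpa, by simpa,
      fun a ha => by simp [ha, hm a ha], fun m hm => ?_⟩
    by_cases e : m = k + 1
    · subst e; simp [this]
    · simp [Function.update_of_ne e, h6 m (by omega)]
  · obtain rfl : m = 0 := by omega
    simpa

/-- The set of rows in which column `j` of the 0-1 matrix has a one. -/
def colSupport (n : ℕ) (tr : Bool) (m0 : ℕ → ℕ) (j : ℕ) : Finset ℕ :=
  (Finset.range n).filter fun k => 1 ≤ m0 (addr n (!tr) j k)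

theorem ones_heapTree_leafLabel (n : ℕ) (tr : Bool) (m0 : ℕ → ℕ) (j : ℕ) :
    (heapTree (2 ^ Nat.clog 2 n) (leafLabel n tr m0 j) 1).ones = colSupport n tr m0 j := by
  have hle := Nat.le_pow_clog (b := 2) (by norm_num) n
  ext k
  rw [mem_ones_heapTree_one (by intro k; unfold leafLabel; split_ifs <;> simp)]
  simp only [colSupport, Finset.mem_filter, Finset.mem_range, leafLabel]
  split_ifs with h
  · simp [h]; omega
  · simpa using h

/-- The program computes the product, together with witnesses; its cost is almost linear in
`n * (n + MWT M)`. -/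
theorem runs_mixedProg (hn : 1 ≤ n) (M : Matrix (Fin n) (Fin n) Bool) (h0 : s.var 0 = n)
    (hB : ∀ c, s.mem 0 c ≤ 1)
    (hM : ∀ j k : Fin n, s.mem 0 (addr n (!tr) j k) = (M j k).toNat)
    (hmem : ∀ a, a ≠ 0 → s.mem a = fun _ => 0) (hr : s.rmem 2 0 = ⊤) :
    Runs ω (2 ^ (4 * Nat.clog 2 n + 6)) (mixedProg tr) s
      (600 * (n * (n + MWT M)) * (Nat.clog 2 n + 1))
      (RowsDone n tr (colSupport n tr (s.mem 0)) (s.rmem 0) n) := by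
  have hV := sizes_clog hn
  have hN := two_pow_clog_le hn
  have hL : Nat.clog 2 n ≤ n := Nat.clog_le_of_le_pow Nat.lt_two_pow_self.le
  -- Labels of two columns differ only where the rows of `M` do; padding labels are always `0`.
  have hcard := card_allTrees_le_MWT (L := Nat.clog 2 n) hn M (leafLabel n tr (s.mem 0)) (by
    intro j j' k hne
    by_cases hk : k < n
    · refine ⟨hk, fun e => hne ?_⟩
      have h1 := hM j ⟨k, hk⟩
      have h2 := hM j' ⟨k, hk⟩
      simp only at h1 h2
      simp only [leafLabel, h1, h2, e]
    · simp [leafLabel, hk] at hne)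
  refine Runs.mono (Runs.seq (runs_computeSizes hn h0) fun s₁ ⟨h0, hm₁, hr₁, h1, h7⟩ =>
    Runs.seq (runs_computeOffsets hV h0 h1 h7 (by simp [hm₁, hmem]))
      fun s₂ ⟨h0, h1, h7, hr₂, hm₂, h6⟩ =>
    Runs.seq (runs_nameColumns (m0 := s.mem 0) (r0 := s.rmem) hV hB h0 h1 h7
        (by rw [hm₂ 0 (by norm_num), hm₁]) (by rw [hr₂, hr₁])
        (fun a ha ha' => by rw [hm₂ a ha', hm₁, hmem a ha]) h6)
      -- The number of names depends on the state `s₃`, while sequencing needs a time bound fixed in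
      -- advance; it is replaced by the bound in terms of `MWT M`.
      fun s₃ ⟨h0, t, hb⟩ =>
    Runs.mono (T' := n * (n * 60 +
        (n + (2 * 2 ^ Nat.clog 2 n + (Nat.clog 2 n + 1) * MWT M)) * 34 + 54) + 10)
      (runs_productRows (root := s₃.mem 7) (S := colSupport n tr (s.mem 0)) hV hb.names
      (by have := hb.cnt_lt hV; omega) (fun j hj => ?_) h0 ?_) ?_ fun _ h => h) ?_ fun _ h => h
  · obtain ⟨h1, h2⟩ := hb.roots j hj
    exact ⟨h1, by rw [h2, ones_heapTree_leafLabel]⟩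
  · constructor
    · rfl
    · rfl
    · rfl
    · rfl
    · rw [hb.hA]
    · rw [hb.hA, hr]
    · simp [hb.hw]
  · have := hb.names.cnt_le
    gcongr
    omega
  · generalize 2 ^ Nat.clog 2 n = N at *
    generalize Nat.clog 2 n = L at *
    generalize MWT M = W
    have e1 : n * N ≤ n * (2 * n) := Nat.mul_le_mul_left _ hN
    have e2 : n ≤ n * n := Nat.le_mul_of_pos_left _ hn
    have e3 : 1 ≤ n * n := Nat.mul_pos hn hn
    have e4 : 0 ≤ n * n * L := Nat.zero_le _
    have e5 : 0 ≤ n * W * (L + 1) := Nat.zero_le _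
    nlinarith

end

/-! ### Inputs and outputs -/

theorem layout_apply {n : ℕ} {R : Type*} (M : Matrix (Fin n) (Fin n) R) (d : R) (i j : Fin n) :
    layout M d (i * n + j) = M i j := by
  have hi := i.2
  have hj := j.2
  have h : (i : ℕ) * n + j < n * n := by
    calc (i : ℕ) * n + j < i * n + n := by omega
      _ = (i + 1) * n := by ring
      _ ≤ n * n := Nat.mul_le_mul_right _ hi
  have h1 : Fin.divNat ⟨(i : ℕ) * n + j, h⟩ = i := by
    ext
    simp [Fin.divNat, Nat.mul_comm (i : ℕ) n, Nat.mul_add_div (by omega : 0 < n),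
      Nat.div_eq_of_lt hj]
  have h2 : Fin.modNat ⟨(i : ℕ) * n + j, h⟩ = j := by
    ext
    simp [Fin.modNat, Nat.mul_comm (i : ℕ) n, Nat.mod_eq_of_lt hj]
  rw [layout, dif_pos h, h1, h2]

theorem initState_mem_le {n : ℕ} (A : Matrix (Fin n) (Fin n) (WithTop ℝ))
    (B : Matrix (Fin n) (Fin n) Bool) (c : ℕ) : (initState A B).mem 0 c ≤ 1 := by
  simp only [initState, if_true, layout]
  split_ifs
  · exact Bool.toNat_le _
  · exact Nat.zero_le _

theorem initState_mem {n : ℕ} (A : Matrix (Fin n) (Fin n) (WithTop ℝ))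
    (B : Matrix (Fin n) (Fin n) Bool) (i j : Fin n) :
    (initState A B).mem 0 (i * n + j) = (B i j).toNat := by
  simp [initState, layout_apply]

theorem initState_rmem {n : ℕ} (A : Matrix (Fin n) (Fin n) (WithTop ℝ))
    (B : Matrix (Fin n) (Fin n) Bool) (i j : Fin n) :
    (initState A B).rmem 0 (i * n + j) = A i j := by
  simp [initState, layout_apply]

/-- Transfers the machine's guarantee, about sets of natural numbers, to the `Fin n`-indexed minima
defining the products. -/
theorem IsMinWit.fin {n : ℕ} {S : Finset ℕ} {a : ℕ → WithTop ℝ} {v : WithTop ℝ} {w : ℕ}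
    (h : IsMinWit S a v w) {P : Fin n → Bool} {f : Fin n → WithTop ℝ} (hlt : ∀ k ∈ S, k < n)
    (hS : ∀ k : Fin n, (k : ℕ) ∈ S ↔ P k = true) (hf : ∀ k : Fin n, a k = f k) :
    v = (Finset.univ.filter fun k => P k = true).inf f ∧
      (v ≠ ⊤ → ∃ k : Fin n, w = k ∧ P k = true ∧ f k = v) := by
  constructor
  · rw [h.1]
    apply le_antisymm
    · refine Finset.le_inf fun k hk => ?_
      rw [← hf]
      exact Finset.inf_le ((hS k).2 (Finset.mem_filter.1 hk).2)
    · refine Finset.le_inf fun k hk => ?_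
      rw [show a k = f ⟨k, hlt k hk⟩ from hf ⟨k, hlt k hk⟩]
      exact Finset.inf_le (Finset.mem_filter.2
        ⟨Finset.mem_univ _, (hS ⟨k, hlt k hk⟩).1 hk⟩)
  · intro hv
    obtain ⟨h1, h2⟩ := h.2 hv
    exact ⟨⟨w, hlt w h1⟩, rfl, (hS ⟨w, hlt w h1⟩).1 h1, (hf ⟨w, hlt w h1⟩).symm.trans h2⟩

theorem lt_of_mem_colSupport {n : ℕ} {tr : Bool} {m0 : ℕ → ℕ} {j k : ℕ}
    (h : k ∈ colSupport n tr m0 j) : k < n :=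
  Finset.mem_range.1 (Finset.mem_filter.1 h).1

theorem clog_add_one_le (n : ℕ) (hn : 1 ≤ n) :
    (Nat.clog 2 n : ℝ) + 1 ≤ 2 * (1 + Real.log n) := by
  have hn' : (1 : ℝ) ≤ n := by exact_mod_cast hn
  have h1 : ((2 : ℝ)) ^ Nat.clog 2 n ≤ 2 * n := by exact_mod_cast two_pow_clog_le hn
  have h2 := Real.log_le_log (by positivity) h1
  rw [Real.log_pow, Real.log_mul (by norm_num) (by positivity)] at h2
  have h3 := Real.log_two_gt_d9
  have h4 := Real.log_nonneg hn'
  nlinarith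

theorem cost_le {n W t : ℕ} (hn : 1 ≤ n)
    (ht : t ≤ 600 * (n * (n + W)) * (Nat.clog 2 n + 1) *
      ((2 ^ (4 * Nat.clog 2 n + 6)).size + 1)) :
    (t : ℝ) ≤ 19200 * ((n : ℝ) * ((n : ℝ) + (W : ℝ))) * (1 + Real.log n) ^ 2 := by
  -- The bit length of `V` is `4 * L + 7`, so handling one integer costs at most `4 * L + 8 ≤ 8 * (L
  -- + 1)`. With `L + 1 ≤ 2 * (1 + log n)` this gives `600 * 8 * 4 = 19200` and two logarithmic
  -- factors.
  rw [Nat.size_pow] at ht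
  have h1 := clog_add_one_le n hn
  have h2 : (t : ℝ) ≤ 600 * (n * (n + W)) * (Nat.clog 2 n + 1) * (4 * Nat.clog 2 n + 6 + 1 + 1) := by
    exact_mod_cast ht
  calc (t : ℝ) ≤ 600 * (n * (n + W)) * (Nat.clog 2 n + 1) * (4 * Nat.clog 2 n + 6 + 1 + 1) := h2
    _ ≤ 600 * (n * (n + W)) * (Nat.clog 2 n + 1) * (8 * (Nat.clog 2 n + 1)) := by
        gcongr
        linarith [(Nat.cast_nonneg (Nat.clog 2 n) : (0 : ℝ) ≤ _)]
    _ = 4800 * (n * (n + W)) * ((Nat.clog 2 n + 1) ^ 2) := by ring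
    _ ≤ 4800 * (n * (n + W)) * ((2 * (1 + Real.log n)) ^ 2) := by gcongr
    _ = _ := by ring

/-! ### Success for every sequence of coin tosses. -/

theorem le_coinMeasure_of_forall {n : ℕ} {α : ℝ} {E : Set (ℕ → Bool)} (h : ∀ ω, ω ∈ E) :
    1 - 1 / (n : ℝ) ^ α ≤ coinMeasure.real E := by
  rw [Set.eq_univ_of_forall h, measureReal_def, measure_univ, ENNReal.toReal_one]
  have : 0 ≤ 1 / (n : ℝ) ^ α := by positivity
  linarith

theorem mem_successEvent_right {n : ℕ} (hn : 1 ≤ n) (A : Matrix (Fin n) (Fin n) (WithTop ℝ))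
    (B : Matrix (Fin n) (Fin n) Bool) (ω : ℕ → Bool) :
    ω ∈ successEvent (mixedProg false) A B
      (19200 * ((n : ℝ) * ((n : ℝ) + (MWT B.transpose : ℝ))) * (1 + Real.log n) ^ 2)
      (fun C W => C = rightProd A B ∧ IsRightWitness A B W) := by
  obtain ⟨t, s, he, ht, hs⟩ := runs_mixedProg (ω := ω) (tr := false) (s := initState A B) hn
    B.transpose (by simp [initState]) (initState_mem_le A B)
    (fun j k => by simpa [addr] using initState_mem A B k j)
    (fun a ha => by simp [initState, ha]) (by simp [initState])
  have key : ∀ i j : Fin n, _ := fun i j => (hs i i.2 j j.2).fin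
    (P := fun k => B k j) (f := fun k => A i k) (fun k => lt_of_mem_colSupport)
    (fun k => by
      have := initState_mem A B k j
      simp [colSupport, addr, this, Nat.one_le_iff_ne_zero])
    (fun k => by simpa [addr] using initState_rmem A B i k)
  refine ⟨t, s, he, cost_le hn ht, ?_, ?_⟩
  · funext i j
    exact (key i j).1
  · intro i j hij
    obtain ⟨h1, h2⟩ := key i j
    have e : s.rmem 1 (addr n false i j) = rightProd A B i j := h1
    rw [e] at h2
    exact h2 hij

theorem mem_successEvent_left {n : ℕ} (hn : 1 ≤ n) (A : Matrix (Fin n) (Fin n) (WithTop ℝ))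
    (B : Matrix (Fin n) (Fin n) Bool) (ω : ℕ → Bool) :
    ω ∈ successEvent (mixedProg true) A B
      (19200 * ((n : ℝ) * ((n : ℝ) + (MWT B : ℝ))) * (1 + Real.log n) ^ 2)
      (fun C W => C = leftProd B A ∧ IsLeftWitness B A W) := by
  obtain ⟨t, s, he, ht, hs⟩ := runs_mixedProg (ω := ω) (tr := true) (s := initState A B) hn
    B (by simp [initState]) (initState_mem_le A B)
    (fun j k => by simpa [addr] using initState_mem A B j k)
    (fun a ha => by simp [initState, ha]) (by simp [initState])
  -- In the transposed run the outer index is the column of `A` and the inner index the row of `B`.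
  have key : ∀ i j : Fin n, _ := fun i j => (hs j j.2 i i.2).fin
    (P := fun k => B i k) (f := fun k => A k j) (fun k => lt_of_mem_colSupport)
    (fun k => by
      have := initState_mem A B i k
      simp [colSupport, addr, this, Nat.one_le_iff_ne_zero])
    (fun k => by simpa [addr] using initState_rmem A B k j)
  refine ⟨t, s, he, cost_le hn ht, ?_, ?_⟩
  · funext i j
    exact (key i j).1
  · intro i j hij
    obtain ⟨h1, h2⟩ := key i j
    have e : s.rmem 1 (addr n true j i) = leftProd B A i j := h1
    rw [e] at h2
    exact h2 hij

end MixedProduct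

open MixedProduct in
theorem mainTheorem2 (α : ℝ) (hα : 1 ≤ α) :
    (∃ (p : Prog) (c : ℝ) (d : ℕ), ∀ (n : ℕ), 1 ≤ n →
      ∀ (A : Matrix (Fin n) (Fin n) (WithTop ℝ)) (B : Matrix (Fin n) (Fin n) Bool),
        1 - 1 / (n : ℝ) ^ α ≤ coinMeasure.real
          (successEvent p A B
            (c * ((n : ℝ) * ((n : ℝ) + (MWT B.transpose : ℝ))) * (1 + Real.log n) ^ d)
            (fun C W => C = rightProd A B ∧ IsRightWitness A B W))) ∧
    (∃ (p : Prog) (c : ℝ) (d : ℕ), ∀ (n : ℕ), 1 ≤ n →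
      ∀ (A : Matrix (Fin n) (Fin n) (WithTop ℝ)) (B : Matrix (Fin n) (Fin n) Bool),
        1 - 1 / (n : ℝ) ^ α ≤ coinMeasure.real
          (successEvent p A B
            (c * ((n : ℝ) * ((n : ℝ) + (MWT B : ℝ))) * (1 + Real.log n) ^ d)
            (fun C W => C = leftProd B A ∧ IsLeftWitness B A W))) :=
  ⟨⟨mixedProg false, 19200, 2, fun _ hn A B =>
      le_coinMeasure_of_forall fun ω => mem_successEvent_right hn A B ω⟩,
    ⟨mixedProg true, 19200, 2, fun _ hn A B =>
      le_coinMeasure_of_forall fun ω => mem_successEvent_left hn A B ω⟩⟩
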